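/- Let $\mathbb R_+=(0,\infty)$. For $1\le p<\infty$ let $X^p(\mathbb R_+)$ be the space of measurable $f:\mathbb R_+\to\mathbb C$ with $\|f\|_{X^p}=\big(\int_0^\infty |f(x)|^p\,\frac{dx}{x}\big)^{1/p}<\infty$, and let $X^\infty(\mathbb R_+)$ be the space of measurable $f$ with $\|f\|_{X^\infty}=\sup_{x>0}|f(x)|<\infty$. Let $\Theta=x\frac{d}{dx}$ be the infinitesimal generator of the group $U(t)f(x)=f(e^tx)$, $t\in\mathbb R$, in $X^p(\mathbb R_+)$, that is, $\Theta f=\lim_{t\to0}\frac{U(t)f-f}{t}$ in the norm of $X^p(\mathbb R_+)$. For $\sigma>0$ let $\mathbf B^p_\sigma(\Theta)$ be the set of all $f\in X^p(\mathbb R_+)$ which belong to the domain of $\Theta^k$ for every $k\in\mathbb N$ and satisfy $\|\Theta^kf\|_{X^p}\le\sigma^k\|f\|_{X^p}$ for every $k\in\mathbb N$. Let $\{t_k\}_{k\in\mathbb Z}$ be real numbers with $\sup_{k\in\mathbb Z}|t_k-k|<\frac14$, and put $$G(z)=(z-t_0)\prod_{k=1}^\infty\Big(1-\frac z{t_k}\Big)\Big(1-\frac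 z{t_{-k}}\Big),\qquad z\in\mathbb C .$$ **Theorem.** Let $1\le p\le\infty$, $\frac1p+\frac1q=1$, $0<\delta<\pi$, $f\in\mathbf B^p_{\pi-\delta}(\Theta)$ and $g\in X^q(\mathbb R_+)$. Then the product defining $G$ converges for every $z$, $G$ is entire and $G'(t_k)\ne0$ for all $k$; the integral $$\Phi(t)=\int_{\mathbb R_+}f(e^tx)\,g(x)\,\frac{dx}{x}$$ converges absolutely for every $t\in\mathbb R$; and $\Phi$ extends to an entire function, again denoted by $\Phi$, for which $$\Phi(t)=\sum_{k\in\mathbb Z}\Phi(t_k)\,\frac{G(t)}{G'(t_k)\,(t-t_k)},\qquad t\in\mathbb C,$$ uniformly on compact subsets of $\mathbb C$; here the sum is the limit of $\sum_{k=-M}^{N}$ as $M,N\to\infty$ independently, and at $t=t_k$ the $k$-th fraction stands for its limit, $1$. -/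

import Mathlib

open MeasureTheory Set Filter Topology
open scoped ENNReal

noncomputable section

namespace Mellin

/- Functions on the half line `ℝ₊ = (0, ∞)` are represented by functions `ℝ → ℂ`; only their
values on `Ioi 0` matter in what follows. -/

/-- The norm of `X^p(ℝ₊)`: the `L^p(ℝ₊)` norm of `x ↦ f x * x^(-1/p)` if `p < ∞`, and
`sup_{x > 0} |f x|` if `p = ∞`. -/
def xNorm (p : ℝ≥0∞) (f : ℝ → ℂ) : ℝ≥0∞ :=
  if p = ∞ then ⨆ x ∈ Ioi (0 : ℝ), ‖f x‖ₑ
  else eLpNorm (fun x : ℝ => f x * ((x ^ (-1 / p.toReal) : ℝ) : ℂ)) p (volume.restrict (Ioi 0))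

/-- Membership in `X^p(ℝ₊)`: Lebesgue measurable on `ℝ₊`, with finite `X^p` norm. -/
def MemX (p : ℝ≥0∞) (f : ℝ → ℂ) : Prop :=
  AEStronglyMeasurable f (volume.restrict (Ioi 0)) ∧ xNorm p f < ∞

/-- The Mellin translations `U(t) f(x) = f(e^t x)`. -/
def U (t : ℝ) (f : ℝ → ℂ) : ℝ → ℂ := fun x => f (Real.exp t * x)

/-- `h = Θ f`, where `Θ = x d/dx` is the infinitesimal generator of the group `U` in `X^p(ℝ₊)`:
both functions are in `X^p(ℝ₊)` and `(U(t) f - f) / t → h` in the `X^p` norm as `t → 0`. -/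
def IsTheta (p : ℝ≥0∞) (f h : ℝ → ℂ) : Prop :=
  MemX p f ∧ MemX p h ∧
    Tendsto (fun t : ℝ => xNorm p (fun x => (U t f x - f x) / (t : ℂ) - h x)) (𝓝[≠] 0) (𝓝 0)

/-- The Bernstein space `B_σ^p(Θ)`: all `f` which lie in the domain of every power of `Θ`
(the sequence `F` is `F k = Θ^k f`) and satisfy `‖Θ^k f‖ ≤ σ^k ‖f‖` for all `k`. -/
def bernsteinSpace (p : ℝ≥0∞) (σ : ℝ) : Set (ℝ → ℂ) :=
  {f | ∃ F : ℕ → ℝ → ℂ, F 0 = f ∧ (∀ k, IsTheta p (F k) (F (k + 1))) ∧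
    ∀ k, xNorm p (F k) ≤ ENNReal.ofReal σ ^ k * xNorm p f}

/-- The pairing `Φ(t) = ∫_{ℝ₊} f(e^t x) g(x) dx/x`, for real `t`. -/
def pairing (f g : ℝ → ℂ) (t : ℝ) : ℂ :=
  ∫ x in Ioi (0 : ℝ), f (Real.exp t * x) * g x / (x : ℂ)

/-- The paired factor `(1 - z / t_k) (1 - z / t_{-k})`, for `k = n + 1`. -/
def samplingFactor (τ : ℤ → ℝ) (z : ℂ) (n : ℕ) : ℂ :=
  (1 - z / (τ (n + 1) : ℂ)) * (1 - z / (τ (-(n + 1)) : ℂ))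

/-- The generating function
`G(z) = (z - t_0) ∏_{k = 1}^∞ (1 - z / t_k) (1 - z / t_{-k})`. -/
def generatingFunction (τ : ℤ → ℝ) (z : ℂ) : ℂ :=
  (z - (τ 0 : ℂ)) * ∏' n : ℕ, samplingFactor τ z n

/-- The interpolating function `G(z) / (G'(t_k) (z - t_k))`, with the removable singularity at
`z = t_k` filled in by its limit `1`. -/
def samplingKernel (τ : ℤ → ℝ) (k : ℤ) (z : ℂ) : ℂ :=
  if z = (τ k : ℂ) then 1
  else generatingFunction τ z /
    (deriv (generatingFunction τ) (τ k : ℂ) * (z - (τ k : ℂ)))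

end Mellin

end

namespace Mellin

/-! By Hölder and the dilation invariance of dx/x, the pairing is bounded uniformly in t by ‖f‖‖g‖.
Norm convergence of difference quotients therefore passes through it: the k-th derivative of Φ is
the pairing of Θ^k f with g, of size at most B σ^k with σ = π - δ (`exists_pairing_derivatives`).
Hence the Taylor series of Φ converges everywhere and does not depend on its centre; centring at Re
z gives |Φ(z)| ≤ B exp(σ|Im z|) (`exists_entire_extension`).

What remains is Lagrange interpolation at the simple zeros t_k of G. On the circle meeting the real
axis at -M - 1/2 and N + 1/2, Cauchy's formula writes the remainder of the partial sum as G(z)/(2πi)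
∮ Φ(w) / (G(w)(w - z)) dw (`sub_sum_samplingKernel_eq`).

The lower bound for G comes from comparing its product, factor by factor, with Euler's product for
the sine: |sin πw| ≤ C |w|^(4L) |G(w)| away from the nodes (`norm_sin_le_generatingFunction`), where
|t_k - k| ≤ L < 1/4. The circle stays 1/2 away from the integers, so |sin πw| is at least exp(π|Im
w|)/3 there. The integrand is thus O(|w|^(4L-1) exp(-δ|Im w|)), and Jordan's estimate bounds the
integral of the exponential independently of the radius. The remainder is O(min(M,N)^(4L-1)) locally
uniformly in z, and 4L < 1 makes it vanish. -/

/-! ### The pairing: Hölder's inequality and differentiation under Θ. -/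

lemma eLpNorm_weighted_le_xNorm (p : ℝ≥0∞) (f : ℝ → ℂ) :
    eLpNorm (fun x : ℝ => f x * ((x ^ (-1 / p.toReal) : ℝ) : ℂ)) p (volume.restrict (Ioi 0)) ≤
      xNorm p f := by
  unfold xNorm
  split_ifs with h
  -- Here `(∞ : ℝ≥0∞).toReal = 0` and `-1 / 0 = 0`, so the weight is x^0 = 1; the essential supremum
  -- is then at most the supremum.
  · subst h
    rw [eLpNorm_exponent_top]
    refine eLpNormEssSup_le_of_ae_enorm_bound ?_
    filter_upwards [ae_restrict_mem measurableSet_Ioi] with x hx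
    simpa using le_iSup₂ (f := fun x (_ : x ∈ Ioi (0 : ℝ)) => ‖f x‖ₑ) x hx
  · exact le_rfl

lemma xNorm_eq_lintegral {p : ℝ≥0∞} (hp : p ≠ 0) (hp' : p ≠ ∞) (f : ℝ → ℂ) :
    xNorm p f =
      (∫⁻ x in Ioi (0 : ℝ), ‖f x‖ₑ ^ p.toReal * ENNReal.ofReal x⁻¹) ^ (1 / p.toReal) := by
  have hpr : 0 < p.toReal := ENNReal.toReal_pos hp hp'
  rw [xNorm, if_neg hp', eLpNorm_eq_lintegral_rpow_enorm_toReal hp hp']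
  congr 1
  refine setLIntegral_congr_fun measurableSet_Ioi fun x hx => ?_
  have hx : 0 < x := hx
  rw [enorm_mul, ENNReal.mul_rpow_of_nonneg _ _ hpr.le, ← ofReal_norm (Complex.ofReal _),
    Complex.norm_real, Real.norm_of_nonneg (by positivity),
    ENNReal.ofReal_rpow_of_pos (by positivity), ← Real.rpow_mul hx.le,
    div_mul_cancel₀ _ hpr.ne', Real.rpow_neg_one]

lemma xNorm_U_le {p : ℝ≥0∞} (hp : p ≠ 0) (t : ℝ) (f : ℝ → ℂ) : xNorm p (U t f) ≤ xNorm p f := by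
  have hc : 0 < Real.exp t := Real.exp_pos t
  by_cases hp' : p = ∞
  · simp only [xNorm, if_pos hp']
    exact iSup₂_le fun x hx => le_iSup₂ (f := fun x (_ : x ∈ Ioi (0 : ℝ)) => ‖f x‖ₑ)
      (Real.exp t * x) (mul_pos hc hx)
  · rw [xNorm_eq_lintegral hp hp', xNorm_eq_lintegral hp hp']
    refine le_of_eq ?_
    congr 1
    have himage : (fun x => Real.exp t * x) '' Ioi 0 = Ioi (0 : ℝ) := by
      rw [Set.image_mul_left_Ioi hc, mul_zero]
    conv_rhs => rw [← himage]
    rw [lintegral_image_eq_lintegral_abs_deriv_mul (f' := fun _ => Real.exp t) measurableSet_Ioi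
      (fun x _ => by simpa using ((hasDerivAt_id x).const_mul (Real.exp t)).hasDerivWithinAt)
      (mul_right_injective₀ hc.ne').injOn]
    refine setLIntegral_congr_fun measurableSet_Ioi fun x hx => ?_
    have hx : 0 < x := hx
    simp only [U, abs_of_pos hc]
    rw [mul_left_comm, ← ENNReal.ofReal_mul hc.le]
    congr 2
    field_simp

lemma quasiMeasurePreserving_exp_mul (t : ℝ) :
    Measure.QuasiMeasurePreserving (fun x => Real.exp t * x)
      (volume.restrict (Ioi 0)) (volume.restrict (Ioi 0)) := by
  refine Measure.QuasiMeasurePreserving.restrict ⟨by fun_prop, ?_⟩ fun x hx =>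
    mul_pos (Real.exp_pos t) hx
  rw [Real.map_volume_mul_left (Real.exp_pos t).ne']
  exact Measure.smul_absolutelyContinuous

lemma aestronglyMeasurable_U {f : ℝ → ℂ} (hf : AEStronglyMeasurable f (volume.restrict (Ioi 0)))
    (t : ℝ) : AEStronglyMeasurable (U t f) (volume.restrict (Ioi 0)) :=
  hf.comp_quasiMeasurePreserving (quasiMeasurePreserving_exp_mul t)

lemma aestronglyMeasurable_weighted {f : ℝ → ℂ}
    (hf : AEStronglyMeasurable f (volume.restrict (Ioi 0))) (a : ℝ) :
    AEStronglyMeasurable (fun x : ℝ => f x * ((x ^ a : ℝ) : ℂ)) (volume.restrict (Ioi 0)) :=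
  hf.mul (by fun_prop)

lemma exponent_add {p q : ℝ≥0∞} (hpq : 1 / p + 1 / q = 1) :
    -1 / p.toReal + -1 / q.toReal = -1 := by
  have hp : 1 / p ≠ ∞ := fun h => by simp [h] at hpq
  have hq : 1 / q ≠ ∞ := fun h => by simp [h] at hpq
  have := congrArg ENNReal.toReal hpq
  rw [ENNReal.toReal_add hp hq] at this
  simp only [one_div, ENNReal.toReal_inv, ENNReal.toReal_one] at this
  rw [div_eq_mul_inv, div_eq_mul_inv]
  linarith

lemma pairing_integrand_eq {p q : ℝ≥0∞} (hpq : 1 / p + 1 / q = 1) (f g : ℝ → ℂ) {x : ℝ}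
    (hx : 0 < x) : f x * g x / (x : ℂ) =
      (f x * ((x ^ (-1 / p.toReal) : ℝ) : ℂ)) * (g x * ((x ^ (-1 / q.toReal) : ℝ) : ℂ)) := by
  have : ((x ^ (-1 / p.toReal) : ℝ) : ℂ) * ((x ^ (-1 / q.toReal) : ℝ) : ℂ) = (x : ℂ)⁻¹ := by
    rw [← Complex.ofReal_mul, ← Real.rpow_add hx, exponent_add hpq, Real.rpow_neg_one,
      Complex.ofReal_inv]
  rw [div_eq_mul_inv, ← this]
  ring

/-- Splitting 1/x as x^(-1/p) x^(-1/q) reduces the claim to Hölder for Lebesgue measure. The bound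
is free of t because dx/x is dilation invariant. -/
lemma lintegral_pairing_le {p q : ℝ≥0∞} (hp : p ≠ 0) (hpq : 1 / p + 1 / q = 1) {f g : ℝ → ℂ}
    (hf : AEStronglyMeasurable f (volume.restrict (Ioi 0)))
    (hg : AEStronglyMeasurable g (volume.restrict (Ioi 0))) (t : ℝ) :
    ∫⁻ x in Ioi (0 : ℝ), ‖f (Real.exp t * x) * g x / (x : ℂ)‖ₑ ≤ xNorm p f * xNorm q g := by
  have : ENNReal.HolderConjugate p q := ENNReal.holderConjugate_iff.2 (by simpa using hpq)
  have hU := aestronglyMeasurable_U hf t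
  have holder : eLpNorm ((fun x : ℝ => U t f x * ((x ^ (-1 / p.toReal) : ℝ) : ℂ)) •
      (fun x : ℝ => g x * ((x ^ (-1 / q.toReal) : ℝ) : ℂ))) 1 (volume.restrict (Ioi 0)) ≤
      xNorm p (U t f) * xNorm q g :=
    (eLpNorm_smul_le_mul_eLpNorm (p := p) (q := q) (aestronglyMeasurable_weighted hg _)
      (aestronglyMeasurable_weighted hU _)).trans
      (mul_le_mul' (eLpNorm_weighted_le_xNorm p _) (eLpNorm_weighted_le_xNorm q g))
  refine le_trans (le_of_eq ?_) (holder.trans (mul_le_mul' (xNorm_U_le hp t f) le_rfl))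
  rw [eLpNorm_one_eq_lintegral_enorm]
  refine setLIntegral_congr_fun measurableSet_Ioi fun x hx => ?_
  have h := pairing_integrand_eq hpq (U t f) g hx
  simp only [Pi.smul_apply', smul_eq_mul]
  rw [← h, U]

lemma integrableOn_pairing {p q : ℝ≥0∞} (hp : p ≠ 0) (hpq : 1 / p + 1 / q = 1) {f g : ℝ → ℂ}
    (hf : MemX p f) (hg : MemX q g) (t : ℝ) :
    IntegrableOn (fun x : ℝ => f (Real.exp t * x) * g x / (x : ℂ)) (Ioi 0) := by
  refine ⟨?_, (lintegral_pairing_le hp hpq hf.1 hg.1 t).trans_lt (ENNReal.mul_lt_top hf.2 hg.2)⟩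
  exact ((aestronglyMeasurable_U hf.1 t).mul hg.1).div₀ (by fun_prop)

lemma enorm_pairing_le {p q : ℝ≥0∞} (hp : p ≠ 0) (hpq : 1 / p + 1 / q = 1) {f g : ℝ → ℂ}
    (hf : AEStronglyMeasurable f (volume.restrict (Ioi 0)))
    (hg : AEStronglyMeasurable g (volume.restrict (Ioi 0))) (t : ℝ) :
    ‖pairing f g t‖ₑ ≤ xNorm p f * xNorm q g :=
  (enorm_integral_le_lintegral_enorm _).trans (lintegral_pairing_le hp hpq hf hg t)

/-- The error of the difference quotient at t is itself the pairing, at t, of (U(s)f - f)/s - h with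
g, so Hölder bounds it by a norm tending to 0. -/
lemma hasDerivAt_pairing {p q : ℝ≥0∞} (hp : p ≠ 0) (hpq : 1 / p + 1 / q = 1) {f h g : ℝ → ℂ}
    (hfh : IsTheta p f h) (hg : MemX q g) (t : ℝ) :
    HasDerivAt (pairing f g) (pairing h g t) t := by
  obtain ⟨hf, hh, hlim⟩ := hfh
  rw [hasDerivAt_iff_tendsto_slope_zero, tendsto_iff_edist_tendsto_0]
  have hlim' := ENNReal.Tendsto.mul_const (b := xNorm q g) hlim (Or.inr hg.2.ne)
  rw [zero_mul] at hlim'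
  refine tendsto_of_tendsto_of_tendsto_of_le_of_le tendsto_const_nhds hlim' (fun _ => zero_le)
    fun s => ?_
  have hmeas : AEStronglyMeasurable (fun x => (U s f x - f x) / (s : ℂ) - h x)
      (volume.restrict (Ioi 0)) :=
    (((aestronglyMeasurable_U hf.1 s).sub hf.1).div₀ (by fun_prop)).sub hh.1
  have key : s⁻¹ • (pairing f g (t + s) - pairing f g t) - pairing h g t =
      pairing (fun x => (U s f x - f x) / (s : ℂ) - h x) g t := by
    simp only [pairing]
    have h1 := integrableOn_pairing hp hpq hf hg (t + s)
    have h2 := integrableOn_pairing hp hpq hf hg t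
    have h3 : IntegrableOn (fun x : ℝ => s⁻¹ • (f (Real.exp (t + s) * x) * g x / (x : ℂ) -
      f (Real.exp t * x) * g x / (x : ℂ))) (Ioi 0) := (h1.sub h2).smul s⁻¹
    rw [← integral_sub h1 h2, ← integral_smul,
      ← integral_sub h3 (integrableOn_pairing hp hpq hh hg t)]
    congr 1
    ext x
    simp only [U, Complex.real_smul, Complex.ofReal_inv]
    rw [show Real.exp (t + s) * x = Real.exp s * (Real.exp t * x) by
      rw [Real.exp_add]; ring]
    ring
  rw [edist_eq_enorm_sub, key]
  exact enorm_pairing_le hp hpq hmeas hg.1 t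

/-- The successive derivatives of the pairing of a function in a Bernstein space. -/
lemma exists_pairing_derivatives {p q : ℝ≥0∞} (hp : p ≠ 0) (hpq : 1 / p + 1 / q = 1) {σ : ℝ}
    (hσ : 0 ≤ σ) {f g : ℝ → ℂ} (hf : f ∈ bernsteinSpace p σ) (hg : MemX q g) :
    ∃ (D : ℕ → ℝ → ℂ) (B : ℝ), D 0 = pairing f g ∧ (∀ k t, HasDerivAt (D k) (D (k + 1) t) t) ∧
      ∀ k t, ‖D k t‖ ≤ B * σ ^ k := by
  obtain ⟨F, hF0, hF, hbound⟩ := hf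
  have hf : MemX p f := hF0 ▸ (hF 0).1
  refine ⟨fun k => pairing (F k) g, (xNorm p f * xNorm q g).toReal, by simp [hF0],
    fun k t => hasDerivAt_pairing hp hpq (hF k) hg t, fun k t => ?_⟩
  have h := (enorm_pairing_le hp hpq (hF k).1.1 hg.1 t).trans
    (mul_le_mul' (hbound k) le_rfl)
  rw [mul_assoc] at h
  have h' := ENNReal.toReal_mono (ENNReal.mul_ne_top (ENNReal.pow_ne_top ENNReal.ofReal_ne_top)
    (ENNReal.mul_lt_top hf.2 hg.2).ne) h
  rwa [toReal_enorm, ENNReal.toReal_mul, ENNReal.toReal_pow, ENNReal.toReal_ofReal hσ, mul_comm]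
    at h'

/-! ### Entire extension by Taylor series. -/

/-- Differentiating a Taylor polynomial in its centre telescopes to the top term. -/
lemma hasDerivAt_taylor_center {D : ℕ → ℝ → ℂ} (hD : ∀ k t, HasDerivAt (D k) (D (k + 1) t) t)
    (z : ℂ) (N : ℕ) (s : ℝ) :
    HasDerivAt (fun s : ℝ => ∑ k ∈ Finset.range (N + 1), D k s * (z - s) ^ k / (k.factorial : ℂ))
      (D (N + 1) s * (z - s) ^ N / (N.factorial : ℂ)) s := by
  have hlin : HasDerivAt (fun s : ℝ => z - (s : ℂ)) (-1) s := by
    simpa using (Complex.ofRealCLM.hasDerivAt (x := s)).const_sub z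
  induction N with
  | zero => simpa using hD 0 s
  | succ N ih =>
    simp_rw [Finset.sum_range_succ _ (N + 1)]
    refine (ih.add (((hD (N + 1) s).mul (hlin.pow (N + 1))).div_const _)).congr_deriv ?_
    have h1 : (N.factorial : ℂ) ≠ 0 := by exact_mod_cast N.factorial_ne_zero
    have h2 : ((N : ℂ) + 1) ≠ 0 := by exact_mod_cast N.succ_ne_zero
    rw [Nat.factorial_succ]
    push_cast
    simp only [Pi.pow_apply]
    field_simp
    ring

lemma summable_taylor {D : ℕ → ℝ → ℂ} {B σ : ℝ} (hB : ∀ k t, ‖D k t‖ ≤ B * σ ^ k) (z : ℂ)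
    (s : ℝ) : Summable fun k : ℕ => D k s * (z - s) ^ k / (k.factorial : ℂ) := by
  refine Summable.of_norm_bounded
    ((Real.summable_pow_div_factorial (σ * ‖z - s‖)).mul_left B) fun k => ?_
  rw [norm_div, norm_mul, norm_pow, Complex.norm_natCast, mul_pow, ← mul_div_assoc, ← mul_assoc]
  gcongr
  exact hB k s

lemma norm_tsum_taylor_le {D : ℕ → ℝ → ℂ} {B σ : ℝ} (hB : ∀ k t, ‖D k t‖ ≤ B * σ ^ k) (z : ℂ)
    (s : ℝ) : ‖∑' k : ℕ, D k s * (z - s) ^ k / (k.factorial : ℂ)‖ ≤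
      B * Real.exp (σ * ‖z - s‖) := by
  have hsum : HasSum (fun k : ℕ => B * ((σ * ‖z - s‖) ^ k / k.factorial))
      (B * Real.exp (σ * ‖z - s‖)) := by
    refine HasSum.mul_left _ ?_
    rw [Real.exp_eq_exp_ℝ]
    exact NormedSpace.expSeries_div_hasSum_exp _
  refine tsum_of_norm_bounded hsum fun k => ?_
  rw [norm_div, norm_mul, norm_pow, Complex.norm_natCast, mul_pow, ← mul_div_assoc, ← mul_assoc]
  gcongr
  exact hB k s

/-- The derivative of the N-th partial sum in the centre is O((σM)^N / N!) between 0 and s, so by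
the mean value inequality moving the centre changes nothing in the limit. -/
lemma tsum_taylor_center_eq {D : ℕ → ℝ → ℂ} (hD : ∀ k t, HasDerivAt (D k) (D (k + 1) t) t)
    {B σ : ℝ} (hσ : 0 ≤ σ) (hB : ∀ k t, ‖D k t‖ ≤ B * σ ^ k) (z : ℂ) (s : ℝ) :
    ∑' k : ℕ, D k s * (z - s) ^ k / (k.factorial : ℂ) =
      ∑' k : ℕ, D k 0 * z ^ k / (k.factorial : ℂ) := by
  set T : ℕ → ℝ → ℂ := fun N s =>
    ∑ k ∈ Finset.range (N + 1), D k s * (z - s) ^ k / (k.factorial : ℂ) with hT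
  have hlim : ∀ s : ℝ, Tendsto (fun N => T N s) atTop
      (𝓝 (∑' k : ℕ, D k s * (z - s) ^ k / (k.factorial : ℂ))) := fun s =>
    (tendsto_add_atTop_iff_nat 1).2 (summable_taylor hB z s).hasSum.tendsto_sum_nat
  set M : ℝ := ‖z‖ + |s| with hM
  have hB0 : 0 ≤ B := by simpa using (norm_nonneg _).trans (hB 0 0)
  have hest : ∀ N, ‖T N s - T N 0‖ ≤ B * σ * ((σ * M) ^ N / N.factorial) * ‖s - 0‖ := by
    intro N
    refine Convex.norm_image_sub_le_of_norm_hasDerivWithin_le (s := uIcc 0 s)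
      (f' := fun s => D (N + 1) s * (z - s) ^ N / (N.factorial : ℂ))
      (fun x _ => (hasDerivAt_taylor_center hD z N x).hasDerivWithinAt) (fun x hx => ?_)
      (convex_uIcc 0 s) left_mem_uIcc right_mem_uIcc
    have hx' : |x| ≤ |s| := by simpa using abs_sub_left_of_mem_uIcc hx
    have hzx : ‖z - x‖ ≤ M := (norm_sub_le _ _).trans (by
      rw [Complex.norm_real, Real.norm_eq_abs]; linarith)
    rw [norm_div, norm_mul, norm_pow, Complex.norm_natCast]
    calc ‖D (N + 1) x‖ * ‖z - x‖ ^ N / N.factorial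
        ≤ (B * σ ^ (N + 1)) * M ^ N / N.factorial := by
          gcongr
          exact hB _ _
      _ = B * σ * ((σ * M) ^ N / N.factorial) := by rw [mul_pow]; ring
  have hzero : Tendsto (fun N => T N s - T N 0) atTop (𝓝 0) := by
    refine squeeze_zero_norm hest ?_
    have := ((FloorSemiring.tendsto_pow_div_factorial_atTop (σ * M)).const_mul (B * σ)).mul_const
      ‖s - 0‖
    simpa using this
  have h := sub_eq_zero.1 (tendsto_nhds_unique ((hlim s).sub (hlim 0)) hzero)
  simpa using h

/-- A function on `ℝ` whose `k`-th derivatives are `O(σ ^ k)` extends to an entire function of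
exponential type `σ`. -/
lemma exists_entire_extension {D : ℕ → ℝ → ℂ} (hD : ∀ k t, HasDerivAt (D k) (D (k + 1) t) t)
    {B σ : ℝ} (hσ : 0 ≤ σ) (hB : ∀ k t, ‖D k t‖ ≤ B * σ ^ k) :
    ∃ Φ : ℂ → ℂ, Differentiable ℂ Φ ∧ (∀ t : ℝ, Φ t = D 0 t) ∧
      ∀ z : ℂ, ‖Φ z‖ ≤ B * Real.exp (σ * |z.im|) := by
  refine ⟨fun z => ∑' k : ℕ, D k 0 * z ^ k / (k.factorial : ℂ), ?_, fun t => ?_, fun z => ?_⟩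
  · intro z
    have hB0 : 0 ≤ B := by simpa using (norm_nonneg _).trans (hB 0 0)
    have hopen : IsOpen (Metric.ball (0 : ℂ) (‖z‖ + 1)) := Metric.isOpen_ball
    refine (Complex.differentiableOn_tsum_of_summable_norm
      ((Real.summable_pow_div_factorial (σ * (‖z‖ + 1))).mul_left B) (fun k => ?_) hopen
      (fun k w hw => ?_)).differentiableAt (hopen.mem_nhds (by simp))
    · exact Differentiable.differentiableOn (by fun_prop)
    · rw [mem_ball_zero_iff] at hw
      rw [norm_div, norm_mul, norm_pow, Complex.norm_natCast, mul_pow, ← mul_div_assoc,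
        ← mul_assoc]
      gcongr
      exact hB k 0
  · simp only
    -- Centred at t itself, only the constant term survives.
    rw [← tsum_taylor_center_eq hD hσ hB t t, tsum_eq_single 0 (by
      intro k hk; simp [hk])]
    simp
  · simp only
    -- The real centre nearest to z turns ‖z - s‖ into |Im z|.
    rw [← tsum_taylor_center_eq hD hσ hB z z.re]
    refine (norm_tsum_taylor_le hB z z.re).trans (le_of_eq ?_)
    have : z - (z.re : ℂ) = z.im * Complex.I := by
      nth_rewrite 1 [← Complex.re_add_im z]
      ring
    rw [this]
    simp

/-! ### Infinite products with factors 1 + O(1/n²). -/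

section Product

variable {H : ℕ → ℂ → ℂ}

lemma summable_norm_factor
    (hH : ∀ n z, ‖H n z‖ ≤ (‖z‖ + 2 * ‖z‖ ^ 2) * (1 / ((n : ℝ) + 1) ^ 2)) (z : ℂ) :
    Summable fun n => ‖H n z‖ := by
  have : Summable fun n : ℕ => 1 / ((n : ℝ) + 1) ^ 2 := by
    have := (summable_nat_add_iff 1).2 (Real.summable_one_div_nat_pow.2 one_lt_two)
    simpa using this
  exact Summable.of_nonneg_of_le (fun _ => norm_nonneg _) (fun n => hH n z) (this.mul_left _)

lemma differentiable_tprod_factor (hd : ∀ n, Differentiable ℂ (H n))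
    (hH : ∀ n z, ‖H n z‖ ≤ (‖z‖ + 2 * ‖z‖ ^ 2) * (1 / ((n : ℝ) + 1) ^ 2)) :
    Differentiable ℂ fun z => ∏' n, (1 + H n z) := by
  intro z
  have hsum : Summable fun n : ℕ => 1 / ((n : ℝ) + 1) ^ 2 := by
    have := (summable_nat_add_iff 1).2 (Real.summable_one_div_nat_pow.2 one_lt_two)
    simpa using this
  have hopen : IsOpen (Metric.ball (0 : ℂ) (‖z‖ + 1)) := Metric.isOpen_ball
  have hprod := Summable.hasProdLocallyUniformlyOn_nat_one_add (f := H) hopen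
    (hsum.mul_left ((‖z‖ + 1) + 2 * (‖z‖ + 1) ^ 2))
    (Eventually.of_forall fun n w hw => (hH n w).trans (by
      rw [mem_ball_zero_iff] at hw
      gcongr)) (fun n => (hd n).continuous.continuousOn)
  rw [hasProdLocallyUniformlyOn_iff_tendstoLocallyUniformlyOn] at hprod
  refine (hprod.differentiableOn (Eventually.of_forall fun s => ?_) hopen).differentiableAt
    (hopen.mem_nhds (by simp))
  exact Differentiable.differentiableOn (by fun_prop)

end Product

/-! ### The nodes and the simple zeros of the generating function. -/

section Sequence

variable {τ : ℤ → ℝ} {L : ℝ}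

lemma abs_le_of_near (hL : L < 1 / 4) (hτ : ∀ k : ℤ, |τ k - k| ≤ L) {k : ℤ} (hk : k ≠ 0) :
    3 / 4 * |(k : ℝ)| ≤ |τ k| := by
  have h1 : (1 : ℝ) ≤ |(k : ℝ)| := by exact_mod_cast Int.one_le_abs hk
  have h2 := abs_sub_abs_le_abs_sub (k : ℝ) (τ k)
  have h3 := hτ k
  rw [abs_sub_comm] at h3
  linarith

lemma ne_zero_of_near (hL : L < 1 / 4) (hτ : ∀ k : ℤ, |τ k - k| ≤ L) {k : ℤ} (hk : k ≠ 0) :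
    τ k ≠ 0 := by
  have h1 : (1 : ℝ) ≤ |(k : ℝ)| := by exact_mod_cast Int.one_le_abs hk
  have h2 := abs_le_of_near hL hτ hk
  exact abs_pos.1 (by linarith)

lemma injective_of_near (hL : L < 1 / 4) (hτ : ∀ k : ℤ, |τ k - k| ≤ L) :
    Function.Injective τ := by
  intro k l hkl
  by_contra hne
  have h1 : (1 : ℝ) ≤ |((k - l : ℤ) : ℝ)| := by
    exact_mod_cast Int.one_le_abs (sub_ne_zero.2 hne)
  have h2 := abs_le.1 (hτ k)
  have h3 := abs_le.1 (hτ l)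
  rw [hkl] at h2
  push_cast at h1
  have : |(k : ℝ) - l| ≤ 1 / 2 := abs_le.2 ⟨by linarith, by linarith⟩
  linarith

/-- A single factor is only 1 + O(1/n). In the pair the linear term is z(a + b)/(ab), and a + b
stays bounded since the nodes lie near n + 1 and -(n + 1). -/
lemma norm_samplingFactor_sub_one_le (hL : L < 1 / 4) (hτ : ∀ k : ℤ, |τ k - k| ≤ L) (n : ℕ)
    (z : ℂ) : ‖samplingFactor τ z n - 1‖ ≤
      (‖z‖ + 2 * ‖z‖ ^ 2) * (1 / ((n : ℝ) + 1) ^ 2) := by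
  have hk : ((n : ℤ) + 1) ≠ 0 := by omega
  have hk' : -((n : ℤ) + 1) ≠ 0 := by omega
  have ha := abs_le_of_near hL hτ hk
  have hb := abs_le_of_near hL hτ hk'
  have hsum : |τ (n + 1) + τ (-(n + 1))| ≤ 1 / 2 := by
    have h1 := abs_le.1 (hτ (n + 1))
    have h2 := abs_le.1 (hτ (-(n + 1)))
    push_cast at h1 h2
    exact abs_le.2 ⟨by linarith, by linarith⟩
  have ha0 := ne_zero_of_near hL hτ hk
  have hb0 := ne_zero_of_near hL hτ hk'
  unfold samplingFactor
  generalize τ (n + 1) = a at *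
  generalize τ (-(n + 1)) = b at *
  have hn : |((n : ℝ) + 1)| = n + 1 := abs_of_pos (by positivity)
  push_cast at ha hb
  rw [abs_neg] at hb
  rw [hn] at ha hb
  have hac : (a : ℂ) ≠ 0 := by exact_mod_cast ha0
  have hbc : (b : ℂ) ≠ 0 := by exact_mod_cast hb0
  have heq : (1 - z / a) * (1 - z / b) - 1 = (z ^ 2 - z * ((a + b : ℝ) : ℂ)) / ((a * b : ℝ) : ℂ) := by
    push_cast
    field_simp
    ring
  have hn0 : (0 : ℝ) < n + 1 := by positivity
  have hab : 9 / 16 * ((n : ℝ) + 1) ^ 2 ≤ |a * b| := by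
    rw [abs_mul]
    calc 9 / 16 * ((n : ℝ) + 1) ^ 2 = (3 / 4 * (n + 1)) * (3 / 4 * (n + 1)) := by ring
      _ ≤ |a| * |b| := by gcongr
  rw [heq, norm_div, Complex.norm_real, Real.norm_eq_abs]
  calc ‖z ^ 2 - z * ((a + b : ℝ) : ℂ)‖ / |a * b|
      ≤ (‖z‖ ^ 2 + ‖z‖ * (1 / 2)) / (9 / 16 * ((n : ℝ) + 1) ^ 2) := by
        gcongr
        refine (norm_sub_le _ _).trans ?_
        rw [norm_pow, norm_mul, Complex.norm_real, Real.norm_eq_abs]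
        gcongr
    _ = (16 / 9 * ‖z‖ ^ 2 + ‖z‖ * (8 / 9)) * (1 / ((n : ℝ) + 1) ^ 2) := by
        field_simp
        ring
    _ ≤ _ := by
        refine mul_le_mul_of_nonneg_right ?_ (by positivity)
        nlinarith [norm_nonneg z, sq_nonneg ‖z‖]

lemma differentiable_samplingFactor (τ : ℤ → ℝ) (n : ℕ) :
    Differentiable ℂ fun z => samplingFactor τ z n := by
  unfold samplingFactor
  simp_rw [div_eq_mul_inv]
  fun_prop

lemma multipliable_samplingFactor (hL : L < 1 / 4) (hτ : ∀ k : ℤ, |τ k - k| ≤ L) (z : ℂ) :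
    Multipliable (samplingFactor τ z) := by
  have := multipliable_one_add_of_summable (summable_norm_factor
    (H := fun n z => samplingFactor τ z n - 1) (norm_samplingFactor_sub_one_le hL hτ) z)
  simpa using this

lemma differentiable_tprod_samplingFactor (hL : L < 1 / 4) (hτ : ∀ k : ℤ, |τ k - k| ≤ L) :
    Differentiable ℂ fun z => ∏' n, samplingFactor τ z n := by
  have := differentiable_tprod_factor (H := fun n z => samplingFactor τ z n - 1)
    (fun n => (differentiable_samplingFactor τ n).sub_const 1)
    (norm_samplingFactor_sub_one_le hL hτ)
  simpa using this

lemma differentiable_generatingFunction (hL : L < 1 / 4) (hτ : ∀ k : ℤ, |τ k - k| ≤ L) :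
    Differentiable ℂ (generatingFunction τ) :=
  (differentiable_id.sub_const _).mul (differentiable_tprod_samplingFactor hL hτ)

lemma one_sub_div_ne_zero (hL : L < 1 / 4) (hτ : ∀ k : ℤ, |τ k - k| ≤ L) {k : ℤ} (hk : k ≠ 0)
    {z : ℂ} (hz : z ≠ τ k) : 1 - z / (τ k : ℂ) ≠ 0 := by
  have h0 : (τ k : ℂ) ≠ 0 := by exact_mod_cast ne_zero_of_near hL hτ hk
  rw [sub_ne_zero]
  intro h
  exact hz ((div_eq_one_iff_eq h0).1 h.symm)

lemma tprod_samplingFactor_ne_zero (hL : L < 1 / 4) (hτ : ∀ k : ℤ, |τ k - k| ≤ L) {z : ℂ}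
    (hz : ∀ k : ℤ, k ≠ 0 → z ≠ τ k) : ∏' n, samplingFactor τ z n ≠ 0 := by
  have := tprod_one_add_ne_zero_of_summable (f := fun n => samplingFactor τ z n - 1) (fun n => ?_)
    (summable_norm_factor (H := fun n z => samplingFactor τ z n - 1)
      (norm_samplingFactor_sub_one_le hL hτ) z)
  · simpa using this
  · rw [add_sub_cancel]
    exact mul_ne_zero (one_sub_div_ne_zero hL hτ (by omega) (hz _ (by omega)))
      (one_sub_div_ne_zero hL hτ (by omega) (hz _ (by omega)))

lemma generatingFunction_ne_zero (hL : L < 1 / 4) (hτ : ∀ k : ℤ, |τ k - k| ≤ L) {z : ℂ}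
    (hz : ∀ k : ℤ, z ≠ τ k) : generatingFunction τ z ≠ 0 :=
  mul_ne_zero (sub_ne_zero.2 (hz 0)) (tprod_samplingFactor_ne_zero hL hτ fun k _ => hz k)

/-- P is the product with its m-th factor replaced by 1, which leaves the convergence estimates
intact. -/
lemma exists_tprod_eq_samplingFactor_mul (hL : L < 1 / 4) (hτ : ∀ k : ℤ, |τ k - k| ≤ L) (m : ℕ) :
    ∃ P : ℂ → ℂ, Differentiable ℂ P ∧
      (∀ z, ∏' n, samplingFactor τ z n = samplingFactor τ z m * P z) ∧
      ∀ z, (∀ n, n ≠ m → samplingFactor τ z n ≠ 0) → P z ≠ 0 := by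
  set H : ℕ → ℂ → ℂ := fun n z => if n = m then 0 else samplingFactor τ z n - 1 with hHdef
  have hH : ∀ n z, ‖H n z‖ ≤ (‖z‖ + 2 * ‖z‖ ^ 2) * (1 / ((n : ℝ) + 1) ^ 2) := by
    intro n z
    simp only [hHdef]
    split_ifs
    · rw [norm_zero]; positivity
    · exact norm_samplingFactor_sub_one_le hL hτ n z
  have hd : ∀ n, Differentiable ℂ (H n) := by
    intro n
    simp only [hHdef]
    split_ifs
    · fun_prop
    · exact (differentiable_samplingFactor τ n).sub_const 1
  have hone : ∀ z n, 1 + H n z = if n = m then 1 else samplingFactor τ z n := by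
    intro z n
    simp only [hHdef]
    split_ifs <;> ring
  refine ⟨fun z => ∏' n, (1 + H n z), differentiable_tprod_factor hd hH, fun z => ?_,
    fun z hz => ?_⟩
  · simp_rw [hone]
    refine Multipliable.tprod_eq_mul_tprod_ite' m ?_
    have := multipliable_one_add_of_summable (summable_norm_factor hH z)
    refine this.congr fun n => ?_
    rw [hone, Function.update_apply]
  · refine tprod_one_add_ne_zero_of_summable (fun n => ?_) (summable_norm_factor hH z)
    rw [hone]
    split_ifs with h
    · exact one_ne_zero
    · exact hz n h

/-- Every point of the sequence is a simple zero of the generating function. -/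
lemma exists_generatingFunction_eq_sub_mul (hL : L < 1 / 4) (hτ : ∀ k : ℤ, |τ k - k| ≤ L)
    (k : ℤ) : ∃ R : ℂ → ℂ, Differentiable ℂ R ∧ R (τ k) ≠ 0 ∧
      ∀ z, generatingFunction τ z = (z - τ k) * R z := by
  have hinj := injective_of_near hL hτ
  have hne : ∀ {l}, l ≠ k → (τ k : ℂ) ≠ τ l := fun {l} hl h =>
    hl (hinj (Complex.ofReal_injective h)).symm
  rcases eq_or_ne k 0 with rfl | hk
  · exact ⟨_, differentiable_tprod_samplingFactor hL hτ,
      tprod_samplingFactor_ne_zero hL hτ fun l hl => hne hl, fun _ => rfl⟩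
  obtain ⟨m, hm⟩ : ∃ m : ℕ, k = m + 1 ∨ k = -(m + 1) := by
    refine ⟨k.natAbs - 1, ?_⟩
    omega
  obtain ⟨P, hP, hPeq, hP0⟩ := exists_tprod_eq_samplingFactor_mul hL hτ m
  have hP1 : P (τ k) ≠ 0 := hP0 _ fun n hn => mul_ne_zero
    (one_sub_div_ne_zero hL hτ (by omega) (hne (by omega)))
    (one_sub_div_ne_zero hL hτ (by omega) (hne (by omega)))
  have hk0 : (τ k : ℂ) ≠ 0 := by exact_mod_cast ne_zero_of_near hL hτ hk
  have hnk : (τ k : ℂ) ≠ τ (-k) := hne (by omega)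
  refine ⟨fun z => (z - τ 0) * (-(τ k : ℂ)⁻¹) * (1 - z / τ (-k)) * P z, ?_, ?_, fun z => ?_⟩
  · simp_rw [div_eq_mul_inv]
    fun_prop
  · refine mul_ne_zero (mul_ne_zero (mul_ne_zero (sub_ne_zero.2 (hne hk.symm)) ?_)
      (one_sub_div_ne_zero hL hτ (by omega) hnk)) hP1
    exact neg_ne_zero.2 (inv_ne_zero hk0)
  · have hfac : samplingFactor τ z m = (1 - z / τ k) * (1 - z / τ (-k)) := by
      rcases hm with rfl | rfl
      · rfl
      · rw [samplingFactor, neg_neg, mul_comm]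
    rw [generatingFunction, hPeq, hfac]
    have : 1 - z / τ k = (z - τ k) * (-(τ k : ℂ)⁻¹) := by
      field_simp
      ring
    rw [this]
    ring

lemma deriv_generatingFunction_ne_zero (hL : L < 1 / 4) (hτ : ∀ k : ℤ, |τ k - k| ≤ L) (k : ℤ) :
    deriv (generatingFunction τ) (τ k) ≠ 0 := by
  obtain ⟨R, hR, hR0, hG⟩ := exists_generatingFunction_eq_sub_mul hL hτ k
  have : HasDerivAt (generatingFunction τ) (R (τ k)) (τ k) := by
    rw [show generatingFunction τ = fun z => (z - τ k) * R z from funext hG]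
    exact (((hasDerivAt_id (τ k : ℂ)).sub_const (τ k : ℂ)).mul
      (hR (τ k)).hasDerivAt).congr_deriv (by simp)
  rwa [this.deriv]

lemma generatingFunction_apply_node (hL : L < 1 / 4) (hτ : ∀ k : ℤ, |τ k - k| ≤ L) (k : ℤ) :
    generatingFunction τ (τ k) = 0 := by
  obtain ⟨R, -, -, hG⟩ := exists_generatingFunction_eq_sub_mul hL hτ k
  simp [hG]

end Sequence

/-! ### Elementary sums behind the exponent 4L. -/

lemma sum_inv_succ_le (n : ℕ) : ∑ i ∈ Finset.range n, 1 / ((i : ℝ) + 1) ≤ 1 + Real.log n := by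
  have := harmonic_le_one_add_log n
  simpa [harmonic] using this

lemma sum_inv_succ_sq_le (n : ℕ) : ∑ i ∈ Finset.range n, 1 / ((i : ℝ) + 1) ^ 2 ≤ 2 := by
  have key : ∀ n : ℕ, ∑ i ∈ Finset.range (n + 1), 1 / ((i : ℝ) + 1) ^ 2 ≤ 2 - 1 / ((n : ℝ) + 1) := by
    intro n
    induction n with
    | zero => norm_num
    | succ n ih =>
      rw [Finset.sum_range_succ]
      have h : 1 / (((n + 1 : ℕ) : ℝ) + 1) ^ 2 ≤ 1 / ((n : ℝ) + 1) - 1 / (((n + 1 : ℕ) : ℝ) + 1) := by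
        push_cast
        rw [div_sub_div _ _ (by positivity) (by positivity), div_le_div_iff₀ (by positivity)
          (by positivity)]
        nlinarith [(Nat.cast_nonneg n : (0 : ℝ) ≤ n)]
      linarith
  rcases n with _ | n
  · norm_num
  · have : 0 ≤ 1 / ((n : ℝ) + 1) := by positivity
    linarith [key n]

lemma sum_Ico_inv_succ_sq_le {K n : ℕ} (hK : 0 < K) (hn : K ≤ n) :
    ∑ i ∈ Finset.Ico K n, 1 / ((i : ℝ) + 1) ^ 2 ≤ 1 / (K : ℝ) - 1 / n := by
  induction n, hn using Nat.le_induction with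
  | base => simp
  | succ n hn ih =>
    rw [Finset.sum_Ico_succ_top hn]
    have hn0 : (0 : ℝ) < n := by exact_mod_cast hK.trans_le hn
    have h : 1 / ((n : ℝ) + 1) ^ 2 ≤ 1 / (n : ℝ) - 1 / ((n + 1 : ℕ) : ℝ) := by
      push_cast
      rw [div_sub_div _ _ (by positivity) (by positivity), div_le_div_iff₀ (by positivity)
        (by positivity)]
      nlinarith
    linarith

lemma sum_Icc_neg_eq (F : ℤ → ℝ) (n : ℕ) :
    ∑ k ∈ Finset.Icc (-(n : ℤ)) n, F k =
      F 0 + ∑ i ∈ Finset.range n, (F (i + 1) + F (-(i + 1))) := by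
  induction n with
  | zero => simp
  | succ n ih =>
    push_cast
    rw [Finset.sum_Icc_succ_eq_add_endpoints, ih, Finset.sum_range_succ]
    ring

/-- The window [-K, K] shifted by -m lies in the symmetric window of half-width K + |m|. -/
lemma sum_pair_shift_le {h : ℕ → ℝ} (hh : ∀ j, 0 ≤ h j) (m : ℤ) (K : ℕ) :
    ∑ i ∈ Finset.range K, (h ((i : ℤ) + 1 - m).natAbs + h (-((i : ℤ) + 1) - m).natAbs) ≤
      h 0 + 2 * ∑ i ∈ Finset.range (K + m.natAbs), h (i + 1) := by
  have h1 := sum_Icc_neg_eq (fun k => h (k - m).natAbs) K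
  have h2 := sum_Icc_neg_eq (fun k => h k.natAbs) (K + m.natAbs)
  have h3 : ∑ k ∈ Finset.Icc (-(K : ℤ)) K, h (k - m).natAbs ≤
      ∑ k ∈ Finset.Icc (-((K + m.natAbs : ℕ) : ℤ)) (K + m.natAbs : ℕ), h k.natAbs := by
    rw [← Finset.sum_image (s := Finset.Icc (-(K : ℤ)) K) (g := fun k => k - m)
      (f := fun k => h k.natAbs) (fun a _ b _ hab => by simpa using hab)]
    refine Finset.sum_le_sum_of_subset_of_nonneg (fun j hj => ?_) fun _ _ _ => hh _
    simp only [Finset.mem_image, Finset.mem_Icc] at hj ⊢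
    omega
  rw [h1, h2] at h3
  have h4 : ∀ i : ℕ, h ((i : ℤ) + 1).natAbs + h (-((i : ℤ) + 1)).natAbs = 2 * h (i + 1) := by
    intro i
    rw [Int.natAbs_neg, show ((i : ℤ) + 1).natAbs = i + 1 by omega]
    ring
  simp only [h4, ← Finset.mul_sum, Int.natAbs_zero] at h3
  linarith [hh (0 - m).natAbs]

/-- A bound for the reciprocal of the distance from a point to the nodes, as a function of the
difference of the index of the node and the integer closest to the point. -/
noncomputable def reciprocalBound (j : ℕ) : ℝ := if j ≤ 1 then 4 else 1 / ((j : ℝ) - 1)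

lemma reciprocalBound_nonneg (j : ℕ) : 0 ≤ reciprocalBound j := by
  unfold reciprocalBound
  split_ifs with h
  · norm_num
  · have : (1 : ℝ) < j := by exact_mod_cast not_le.1 h
    exact div_nonneg zero_le_one (by linarith)

lemma sum_reciprocalBound_le (J : ℕ) :
    ∑ i ∈ Finset.range (J + 1), reciprocalBound (i + 1) ≤ 5 + Real.log (J + 1) := by
  rw [Finset.sum_range_succ']
  have h : ∀ i : ℕ, reciprocalBound (i + 1 + 1) = 1 / ((i : ℝ) + 1) := by
    intro i
    rw [reciprocalBound, if_neg (by omega)]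
    push_cast
    ring
  have h0 : reciprocalBound (0 + 1) = 4 := by simp [reciprocalBound]
  simp only [h, h0]
  have hlog : Real.log J ≤ Real.log (J + 1) := by
    rcases J.eq_zero_or_pos with rfl | hJ
    · simp
    · have : (0 : ℝ) < J := by exact_mod_cast hJ
      exact Real.log_le_log this (by linarith)
  linarith [sum_inv_succ_le J]

lemma sum_reciprocalBound_sq_le (J : ℕ) :
    ∑ i ∈ Finset.range (J + 1), reciprocalBound (i + 1) ^ 2 ≤ 18 := by
  rw [Finset.sum_range_succ']
  have h : ∀ i : ℕ, reciprocalBound (i + 1 + 1) ^ 2 = 1 / ((i : ℝ) + 1) ^ 2 := by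
    intro i
    rw [reciprocalBound, if_neg (by omega), div_pow, one_pow]
    push_cast
    ring
  have h0 : reciprocalBound (0 + 1) = 4 := by simp [reciprocalBound]
  simp only [h, h0]
  linarith [sum_inv_succ_sq_le J]

/-- `∑ r / (|k| w k) ≤ 4 log r + O(1)`, where `w k` behaves like the distance from a point of
modulus `r` to the integer `k`. -/
lemma sum_div_mul_le {r : ℝ} (hr : 1 ≤ r) {w : ℤ → ℝ} {m : ℤ} (hm : |(m : ℝ)| ≤ r + 1 / 2)
    (hw : ∀ k, 0 < w k) (hw1 : ∀ k, 1 / w k ≤ reciprocalBound (k - m).natAbs)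
    (hw2 : ∀ k : ℤ, r ≤ w k + |(k : ℝ)| + 1 / 4) (hw3 : ∀ k : ℤ, |(k : ℝ)| - 1 / 4 - r ≤ w k)
    {n : ℕ} (hn : ⌊2 * r⌋₊ ≤ n) :
    ∑ i ∈ Finset.range n, (r / (((i : ℝ) + 1) * w (i + 1)) + r / (((i : ℝ) + 1) * w (-(i + 1)))) ≤
      4 * Real.log r + 92 := by
  set K := ⌊2 * r⌋₊ with hKdef
  have hK2 : (K : ℝ) ≤ 2 * r := Nat.floor_le (by linarith)
  have hK1 : 2 * r < K + 1 := Nat.lt_floor_add_one _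
  have hKr : r ≤ K := by linarith
  have hK0 : 0 < K := by
    have : (0 : ℝ) < K := by linarith
    exact_mod_cast this
  have habs : ∀ i : ℕ, |(((i : ℤ) + 1 : ℤ) : ℝ)| = i + 1 ∧
      |((-((i : ℤ) + 1) : ℤ) : ℝ)| = i + 1 := by
    intro i
    have : |(i : ℝ) + 1| = i + 1 := abs_of_pos (by positivity)
    push_cast
    rw [abs_neg]
    exact ⟨this, this⟩
  -- Partial fractions: r ≤ w + |k| + 1/4 gives r/(|k|w) ≤ 1/|k| + 1/w + 1/(4|k|w). Summed over both
  -- signs of k, the first two terms cost 2 log r each; the last is absorbed by squares, whose sums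
  -- are bounded.
  have hnear : ∀ (i : ℕ) (k : ℤ), |(k : ℝ)| = i + 1 → r / (((i : ℝ) + 1) * w k) ≤
      1 / ((i : ℝ) + 1) + 1 / ((i : ℝ) + 1) ^ 2 + reciprocalBound (k - m).natAbs +
        reciprocalBound (k - m).natAbs ^ 2 := by
    intro i k hk
    have hi : (0 : ℝ) < i + 1 := by positivity
    have h2 := hw2 k
    rw [hk] at h2
    have hb := hw1 k
    have hb0 : 0 < 1 / w k := by have := hw k; positivity
    set a := 1 / ((i : ℝ) + 1) with ha
    have ha0 : 0 < a := by positivity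
    have heq : r / (((i : ℝ) + 1) * w k) ≤ a + 1 / w k + 1 / 4 * (a * (1 / w k)) := by
      have hwk := hw k
      rw [ha, div_le_iff₀ (by positivity)]
      field_simp
      linarith
    rw [show 1 / ((i : ℝ) + 1) ^ 2 = a ^ 2 by rw [ha, div_pow, one_pow]]
    nlinarith [sq_nonneg (a - 1 / w k), pow_le_pow_left₀ hb0.le hb 2]
  -- Beyond 2r the weight satisfies w ≥ |k|/4, so this part of the sum is bounded.
  have hfar : ∀ (i : ℕ) (k : ℤ), K ≤ i → |(k : ℝ)| = i + 1 → r / (((i : ℝ) + 1) * w k) ≤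
      4 * r * (1 / ((i : ℝ) + 1) ^ 2) := by
    intro i k hi hk
    have hi' : (K : ℝ) ≤ i := by exact_mod_cast hi
    have h3 := hw3 k
    rw [hk] at h3
    have hw4 : ((i : ℝ) + 1) / 4 ≤ w k := by linarith
    calc r / (((i : ℝ) + 1) * w k) ≤ r / (((i : ℝ) + 1) * (((i : ℝ) + 1) / 4)) := by gcongr
      _ = _ := by field_simp
  have hsplit : ∀ F : ℕ → ℝ, ∑ i ∈ Finset.range n, F i =
      ∑ i ∈ Finset.range K, F i + ∑ i ∈ Finset.Ico K n, F i := by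
    intro F
    rw [Finset.range_eq_Ico, Finset.range_eq_Ico, Finset.sum_Ico_consecutive _ (Nat.zero_le _) hn]
  rw [hsplit]
  have hpart2 : ∑ i ∈ Finset.Ico K n,
      (r / (((i : ℝ) + 1) * w (i + 1)) + r / (((i : ℝ) + 1) * w (-(i + 1)))) ≤ 8 := by
    have h1 : ∑ i ∈ Finset.Ico K n,
        (r / (((i : ℝ) + 1) * w (i + 1)) + r / (((i : ℝ) + 1) * w (-(i + 1)))) ≤
        ∑ i ∈ Finset.Ico K n, 8 * r * (1 / ((i : ℝ) + 1) ^ 2) := by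
      refine Finset.sum_le_sum fun i hi => ?_
      have hi := (Finset.mem_Ico.1 hi).1
      linarith [hfar i _ hi (habs i).1, hfar i _ hi (habs i).2]
    rw [← Finset.mul_sum] at h1
    refine h1.trans ?_
    have hKpos : (0 : ℝ) < K := by linarith
    calc 8 * r * ∑ i ∈ Finset.Ico K n, 1 / ((i : ℝ) + 1) ^ 2 ≤ 8 * r * (1 / (K : ℝ)) := by
          gcongr
          refine (sum_Ico_inv_succ_sq_le hK0 hn).trans ?_
          have : 0 ≤ 1 / (n : ℝ) := by positivity
          linarith
      _ ≤ 8 * K * (1 / (K : ℝ)) := by gcongr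
      _ = 8 := by field_simp
  have hpart1 : ∑ i ∈ Finset.range K,
      (r / (((i : ℝ) + 1) * w (i + 1)) + r / (((i : ℝ) + 1) * w (-(i + 1)))) ≤
      4 * Real.log r + 84 := by
    have h1 : ∑ i ∈ Finset.range K,
        (r / (((i : ℝ) + 1) * w (i + 1)) + r / (((i : ℝ) + 1) * w (-(i + 1)))) ≤
        ∑ i ∈ Finset.range K, (2 * (1 / ((i : ℝ) + 1)) + 2 * (1 / ((i : ℝ) + 1) ^ 2) +
          (reciprocalBound ((i : ℤ) + 1 - m).natAbs +
            reciprocalBound (-((i : ℤ) + 1) - m).natAbs) +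
          (reciprocalBound ((i : ℤ) + 1 - m).natAbs ^ 2 +
            reciprocalBound (-((i : ℤ) + 1) - m).natAbs ^ 2)) := by
      refine Finset.sum_le_sum fun i _ => ?_
      linarith [hnear i _ (habs i).1, hnear i _ (habs i).2]
    refine h1.trans ?_
    rw [Finset.sum_add_distrib, Finset.sum_add_distrib, Finset.sum_add_distrib, ← Finset.mul_sum,
      ← Finset.mul_sum]
    obtain ⟨J, hJ⟩ : ∃ J, K + m.natAbs = J + 1 := ⟨K + m.natAbs - 1, by omega⟩
    have h2 := sum_pair_shift_le reciprocalBound_nonneg m K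
    have h3 := sum_pair_shift_le (h := fun j => reciprocalBound j ^ 2) (fun j => sq_nonneg _) m K
    rw [hJ] at h2 h3
    have h4 := sum_reciprocalBound_le J
    have h5 := sum_reciprocalBound_sq_le J
    have h6 := sum_inv_succ_le K
    have h7 := sum_inv_succ_sq_le K
    have h0 : reciprocalBound 0 = 4 := by simp [reciprocalBound]
    have hlog4 : Real.log 4 ≤ 3 := by
      have := Real.log_le_sub_one_of_pos (show (0 : ℝ) < 4 by norm_num)
      linarith
    have hJr : (J : ℝ) + 1 ≤ 4 * r := by
      have hc : (K : ℝ) + (m.natAbs : ℝ) = J + 1 := by exact_mod_cast hJ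
      have : (m.natAbs : ℝ) = |(m : ℝ)| := by rw [Nat.cast_natAbs]; push_cast; rfl
      linarith
    have hl1 : Real.log (J + 1) ≤ 3 + Real.log r := by
      have := Real.log_le_log (by positivity) hJr
      rw [Real.log_mul (by norm_num) (by linarith)] at this
      linarith
    have hl2 : Real.log K ≤ 3 + Real.log r := by
      have := Real.log_le_log (by linarith) (show (K : ℝ) ≤ 4 * r by linarith)
      rw [Real.log_mul (by norm_num) (by linarith)] at this
      linarith
    simp only [h0] at h2 h3
    linarith
  linarith

/-! ### Comparison of G with the sine, and lower bounds for the sine. -/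

lemma norm_one_sub_div_le {L : ℝ} (hL : L < 1 / 4) {τ : ℤ → ℝ} (hτ : ∀ k : ℤ, |τ k - k| ≤ L)
    {k : ℤ} (hk : k ≠ 0) {z : ℂ} (hz : 0 < ‖(τ k : ℂ) - z‖) :
    ‖1 - z / (k : ℂ)‖ ≤
      ‖1 - z / (τ k : ℂ)‖ * Real.exp (L * (‖z‖ / (|(k : ℝ)| * ‖(τ k : ℂ) - z‖))) := by
  have hk0 : (k : ℂ) ≠ 0 := by exact_mod_cast hk
  have ht0 : (τ k : ℂ) ≠ 0 := by exact_mod_cast ne_zero_of_near hL hτ hk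
  have hz0 : (τ k : ℂ) - z ≠ 0 := norm_pos_iff.1 hz
  have heq : 1 - z / (k : ℂ) = (1 - z / (τ k : ℂ)) *
      (1 - ((τ k - k : ℝ) : ℂ) * z / (k * ((τ k : ℂ) - z))) := by
    push_cast
    field_simp
    ring
  rw [heq, norm_mul]
  gcongr
  have h1 : ‖((τ k - k : ℝ) : ℂ) * z / (k * ((τ k : ℂ) - z))‖ ≤
      L * (‖z‖ / (|(k : ℝ)| * ‖(τ k : ℂ) - z‖)) := by
    rw [norm_div, norm_mul, norm_mul, Complex.norm_real, Real.norm_eq_abs, Complex.norm_intCast,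
      mul_div_assoc]
    exact mul_le_mul_of_nonneg_right (hτ k) (by positivity)
  calc _ ≤ 1 + L * (‖z‖ / (|(k : ℝ)| * ‖(τ k : ℂ) - z‖)) := by
        refine (norm_sub_le _ _).trans ?_
        rw [norm_one]
        linarith
    _ ≤ _ := by
        rw [add_comm]
        exact Real.add_one_le_exp _

lemma sum_node_distance_le {L : ℝ} (hL : L < 1 / 4) {τ : ℤ → ℝ} (hτ : ∀ k : ℤ, |τ k - k| ≤ L)
    {z : ℂ} (hz1 : 1 ≤ ‖z‖) (hz : ∀ k, 1 / 4 ≤ ‖(τ k : ℂ) - z‖) {n : ℕ} (hn : ⌊2 * ‖z‖⌋₊ ≤ n) :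
    ∑ i ∈ Finset.range n, (‖z‖ / (((i : ℝ) + 1) * ‖(τ (i + 1) : ℂ) - z‖) +
      ‖z‖ / (((i : ℝ) + 1) * ‖(τ (-(i + 1)) : ℂ) - z‖)) ≤ 4 * Real.log ‖z‖ + 92 := by
  have hre : ∀ k, |τ k - z.re| ≤ ‖(τ k : ℂ) - z‖ := fun k => by
    simpa using Complex.abs_re_le_norm ((τ k : ℂ) - z)
  have hround := abs_sub_round z.re
  refine sum_div_mul_le hz1 (w := fun k => ‖(τ k : ℂ) - z‖) (m := round z.re) ?_
    (fun k => by linarith [hz k]) (fun k => ?_) (fun k => ?_) (fun k => ?_) hn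
  · have h1 := Complex.abs_re_le_norm z
    have h2 := abs_sub_abs_le_abs_sub ((round z.re : ℤ) : ℝ) z.re
    rw [abs_sub_comm] at h2
    linarith
  · rw [reciprocalBound]
    split_ifs with h
    · rw [div_le_iff₀ (by linarith [hz k])]
      linarith [hz k]
    · have hj : (1 : ℝ) < ((k - round z.re).natAbs : ℝ) := by exact_mod_cast not_le.1 h
      have hj' : ((k - round z.re).natAbs : ℝ) = |(k : ℝ) - (round z.re : ℤ)| := by
        rw [Nat.cast_natAbs]
        push_cast
        rfl
      refine one_div_le_one_div_of_le (by linarith) ?_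
      -- The node is within 1/4 of k and Re z within 1/2 of its rounding, so less than 1 is lost
      -- from |k - m|.
      rw [hj']
      have h1 : |(k : ℝ) - (round z.re : ℤ)| ≤
          |(k : ℝ) - τ k| + |τ k - z.re| + |z.re - (round z.re : ℤ)| :=
        (abs_sub_le _ z.re _).trans (by linarith [abs_sub_le (k : ℝ) (τ k) z.re])
      have h2 := hτ k
      rw [abs_sub_comm] at h2
      linarith [hre k]
  · have h1 : ‖z‖ ≤ ‖(τ k : ℂ)‖ + ‖(τ k : ℂ) - z‖ := by
      have := norm_sub_le (τ k : ℂ) ((τ k : ℂ) - z)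
      rwa [sub_sub_cancel] at this
    rw [Complex.norm_real, Real.norm_eq_abs] at h1
    have h2 := abs_sub_abs_le_abs_sub (τ k) (k : ℝ)
    linarith [hτ k]
  · have h1 := norm_sub_norm_le (τ k : ℂ) z
    rw [Complex.norm_real, Real.norm_eq_abs] at h1
    have h2 := abs_sub_abs_le_abs_sub (k : ℝ) (τ k)
    rw [abs_sub_comm] at h2
    linarith [hτ k]

/-- Comparison of the generating function with the sine. -/
lemma norm_sin_le_generatingFunction {L : ℝ} (hL : L < 1 / 4) {τ : ℤ → ℝ}
    (hτ : ∀ k : ℤ, |τ k - k| ≤ L) {z : ℂ} (hz1 : 1 ≤ ‖z‖) (hz : ∀ k, 1 / 4 ≤ ‖(τ k : ℂ) - z‖) :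
    ‖Complex.sin (Real.pi * z)‖ ≤
      2 * Real.pi * Real.exp 23 * ‖z‖ ^ (4 * L) * ‖generatingFunction τ z‖ := by
  have hL0 : 0 ≤ L := (abs_nonneg _).trans (hτ 0)
  set E : ℝ := Real.exp 23 * ‖z‖ ^ (4 * L) with hE
  have hfin : ∀ n ≥ ⌊2 * ‖z‖⌋₊, ‖Real.pi * z * ∏ j ∈ Finset.range n,
      ((1 : ℂ) - z ^ 2 / ((j : ℂ) + 1) ^ 2)‖ ≤
      Real.pi * ‖z‖ * (‖∏ j ∈ Finset.range n, samplingFactor τ z j‖ * E) := by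
    intro n hn
    rw [norm_mul, norm_mul, Complex.norm_real, Real.norm_of_nonneg Real.pi_pos.le]
    gcongr
    rw [Finset.prod_congr rfl (g := fun j : ℕ => (1 - z / (((j : ℤ) + 1 : ℤ) : ℂ)) *
      (1 - z / ((-((j : ℤ) + 1) : ℤ) : ℂ))) (fun j _ => by
        have : (j : ℂ) + 1 ≠ 0 := by exact_mod_cast j.succ_ne_zero
        push_cast
        field_simp
        ring)]
    rw [norm_prod, norm_prod]
    calc ∏ j ∈ Finset.range n, ‖(1 - z / (((j : ℤ) + 1 : ℤ) : ℂ)) *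
          (1 - z / ((-((j : ℤ) + 1) : ℤ) : ℂ))‖
        ≤ ∏ j ∈ Finset.range n, (‖samplingFactor τ z j‖ *
          Real.exp (L * (‖z‖ / (((j : ℝ) + 1) * ‖(τ (j + 1) : ℂ) - z‖) +
            ‖z‖ / (((j : ℝ) + 1) * ‖(τ (-(j + 1)) : ℂ) - z‖)))) := by
          refine Finset.prod_le_prod (fun _ _ => norm_nonneg _) fun j _ => ?_
          have h1 := norm_one_sub_div_le hL hτ (k := (j : ℤ) + 1) (by omega) (z := z)
            (by linarith [hz (j + 1)])
          have h2 := norm_one_sub_div_le hL hτ (k := -((j : ℤ) + 1)) (by omega) (z := z)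
            (by linarith [hz (-(j + 1))])
          have habs : |(((j : ℤ) + 1 : ℤ) : ℝ)| = j + 1 ∧ |((-((j : ℤ) + 1) : ℤ) : ℝ)| = j + 1 := by
            have : |(j : ℝ) + 1| = j + 1 := abs_of_pos (by positivity)
            push_cast
            rw [abs_neg]
            exact ⟨this, this⟩
          rw [habs.1] at h1
          rw [habs.2] at h2
          rw [norm_mul, samplingFactor, norm_mul, mul_add, Real.exp_add]
          refine (mul_le_mul h1 h2 (norm_nonneg _) (by positivity)).trans (le_of_eq ?_)
          ring
      _ = (∏ j ∈ Finset.range n, ‖samplingFactor τ z j‖) *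
          Real.exp (L * ∑ j ∈ Finset.range n, (‖z‖ / (((j : ℝ) + 1) * ‖(τ (j + 1) : ℂ) - z‖) +
            ‖z‖ / (((j : ℝ) + 1) * ‖(τ (-(j + 1)) : ℂ) - z‖))) := by
          rw [Finset.prod_mul_distrib, Finset.mul_sum, Real.exp_sum]
      _ ≤ (∏ j ∈ Finset.range n, ‖samplingFactor τ z j‖) * E := by
          gcongr
          -- L (4 log‖z‖ + 92) ≤ 4L log‖z‖ + 23, because L < 1/4.
          rw [hE, Real.rpow_def_of_pos (by linarith), ← Real.exp_add]
          gcongr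
          have := mul_le_mul_of_nonneg_left (sum_node_distance_le hL hτ hz1 hz hn) hL0
          linarith
  have hlim1 := (Complex.tendsto_euler_sin_prod z).norm
  have hlim2 := (((multipliable_samplingFactor hL hτ z).hasProd.tendsto_prod_nat.norm).mul_const
    E).const_mul (Real.pi * ‖z‖)
  have hle := le_of_tendsto_of_tendsto hlim1 hlim2
    (eventually_atTop.2 ⟨_, hfin⟩)
  refine hle.trans ?_
  have h0 : ‖z‖ ≤ 2 * ‖z - τ 0‖ := by
    have h1 := norm_sub_norm_le z (τ 0 : ℂ)
    have h2 := hτ 0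
    rw [Complex.norm_real, Real.norm_eq_abs] at h1
    simp only [Int.cast_zero, sub_zero] at h2
    linarith
  rw [generatingFunction, norm_mul]
  have hE0 : 0 ≤ E := by positivity
  calc Real.pi * ‖z‖ * (‖∏' n, samplingFactor τ z n‖ * E)
      ≤ Real.pi * (2 * ‖z - τ 0‖) * (‖∏' n, samplingFactor τ z n‖ * E) := by gcongr
    _ = _ := by rw [hE]; ring

lemma normSq_sin (z : ℂ) :
    ‖Complex.sin z‖ ^ 2 = Real.sin z.re ^ 2 + Real.sinh z.im ^ 2 := by
  have h : Complex.sin z = ((Real.sin z.re * Real.cosh z.im : ℝ) : ℂ) +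
      ((Real.cos z.re * Real.sinh z.im : ℝ) : ℂ) * Complex.I := by
    rw [Complex.sin_eq]
    push_cast
    rfl
  rw [h, Complex.sq_norm, Complex.normSq_add_mul_I, mul_pow, mul_pow, Real.cosh_sq, Real.cos_sq']
  ring

/-- With s the signed distance from Re z to its nearest integer, |sin πz|² = sin²(πs) + sinh²(πy) ≥
4(s² + y²) ≥ 1. Then exp(2π|y|)/4 ≤ cosh²(πy) = 1 + sinh²(πy) ≤ 2|sin πz|², and 8 ≤ 3². -/
lemma exp_le_norm_sin {z : ℂ} (hz : ∀ k : ℤ, 1 / 2 ≤ ‖(k : ℂ) - z‖) :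
    Real.exp (Real.pi * |z.im|) ≤ 3 * ‖Complex.sin (Real.pi * z)‖ := by
  set k := round z.re with hk
  set s := z.re - k with hs
  have hs2 : |s| ≤ 1 / 2 := abs_sub_round z.re
  have hsy : 1 / 4 ≤ s ^ 2 + z.im ^ 2 := by
    have h1 : ‖(k : ℂ) - z‖ ^ 2 = s ^ 2 + z.im ^ 2 := by
      rw [Complex.sq_norm, Complex.normSq_apply]
      simp only [Complex.sub_re, Complex.sub_im, Complex.intCast_re, Complex.intCast_im, hs]
      ring
    nlinarith [hz k]
  have hsin : 4 * s ^ 2 ≤ Real.sin (Real.pi * z.re) ^ 2 := by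
    have h1 : Real.sin (Real.pi * s) ^ 2 = Real.sin (Real.pi * z.re) ^ 2 := by
      rw [hs, mul_sub, mul_comm Real.pi (k : ℝ), Real.sin_sub_int_mul_pi, mul_pow]
      have : ((-1 : ℝ) ^ k) ^ 2 = 1 := by
        rw [← zpow_natCast, ← zpow_mul, mul_comm, zpow_mul]
        norm_num
      rw [this, one_mul]
    have h2 : |Real.pi * s| = Real.pi * |s| := by rw [abs_mul, abs_of_pos Real.pi_pos]
    have h3 := Real.mul_abs_le_abs_sin (x := Real.pi * s) (by
      rw [h2]; nlinarith [Real.pi_pos])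
    rw [h2, show 2 / Real.pi * (Real.pi * |s|) = 2 * |s| by field_simp [Real.pi_ne_zero]] at h3
    rw [← h1, ← sq_abs s, ← sq_abs (Real.sin (Real.pi * s))]
    nlinarith [abs_nonneg s]
  set u := Real.pi * |z.im| with hu
  have hu0 : 0 ≤ u := mul_nonneg Real.pi_pos.le (abs_nonneg _)
  have hsinhu : Real.sinh (Real.pi * z.im) ^ 2 = Real.sinh u ^ 2 := by
    rw [← sq_abs (Real.sinh (Real.pi * z.im)), Real.abs_sinh, abs_mul, abs_of_pos Real.pi_pos]
  have hsinh : 4 * z.im ^ 2 ≤ Real.sinh u ^ 2 := by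
    have h1 : u ≤ Real.sinh u := Real.self_le_sinh_iff.2 hu0
    have h2 : 2 * |z.im| ≤ u := by nlinarith [Real.pi_gt_three, abs_nonneg z.im]
    rw [← sq_abs z.im]
    nlinarith [abs_nonneg z.im]
  have hnorm : ‖Complex.sin (Real.pi * z)‖ ^ 2 =
      Real.sin (Real.pi * z.re) ^ 2 + Real.sinh u ^ 2 := by
    rw [normSq_sin, Complex.re_ofReal_mul, Complex.im_ofReal_mul, hsinhu]
  have hcosh : (Real.exp u / 2) ^ 2 ≤ 1 + Real.sinh u ^ 2 := by
    rw [add_comm, ← Real.cosh_sq]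
    have : Real.exp u / 2 ≤ Real.cosh u := by
      rw [Real.cosh_eq]
      linarith [Real.exp_pos (-u)]
    exact pow_le_pow_left₀ (by positivity) this 2
  refine abs_le_of_sq_le_sq' ?_ (by positivity) |>.2
  nlinarith [sq_nonneg (Real.sin (Real.pi * z.re))]

/-! ### Jordan's estimate. -/

lemma integral_exp_neg_mul_le {a : ℝ} (ha : 0 < a) :
    ∫ θ in (0 : ℝ)..Real.pi, Real.exp (-(a * θ)) ≤ 1 / a := by
  have hderiv : ∀ θ ∈ uIcc 0 Real.pi,
      HasDerivAt (fun θ => -(1 / a) * Real.exp (-(a * θ))) (Real.exp (-(a * θ))) θ := by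
    intro θ _
    refine (((((hasDerivAt_id θ).const_mul a).neg).exp).const_mul (-(1 / a))).congr_deriv ?_
    simp only [id]
    field_simp
    rfl
  rw [intervalIntegral.integral_eq_sub_of_hasDerivAt hderiv
    (Continuous.intervalIntegrable (by fun_prop) _ _)]
  have : 0 ≤ 1 / a * Real.exp (-(a * Real.pi)) := by positivity
  simp only [mul_zero, neg_zero, Real.exp_zero]
  linarith

/-- Jordan's estimate on the full circle. -/
lemma integral_exp_neg_abs_sin_le {δ R : ℝ} (hδ : 0 < δ) (hR : 0 < R) :
    ∫ θ in (0 : ℝ)..2 * Real.pi, R * Real.exp (-(δ * |R * Real.sin θ|)) ≤ 2 * Real.pi / δ := by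
  set F : ℝ → ℝ := fun θ => R * Real.exp (-(δ * |R * Real.sin θ|)) with hF
  have hcont : Continuous F := by fun_prop
  have hshift : ∫ θ in Real.pi..2 * Real.pi, F θ = ∫ θ in (0 : ℝ)..Real.pi, F θ := by
    have h := intervalIntegral.integral_comp_add_right F (a := 0) (b := Real.pi) Real.pi
    rw [zero_add, ← two_mul] at h
    rw [← h]
    refine intervalIntegral.integral_congr fun θ _ => ?_
    simp [hF, Real.sin_add_pi]
  rw [← intervalIntegral.integral_add_adjacent_intervals (hcont.intervalIntegrable 0 Real.pi)
    (hcont.intervalIntegrable Real.pi _), hshift]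
  set a : ℝ := δ * R * (2 / Real.pi) with ha
  have ha0 : 0 < a := by have := Real.pi_pos; positivity
  -- Use sin θ ≥ 2θ/π on the first quarter and its reflection on the second; adding both
  -- exponentials avoids splitting the integral.
  have hpt : ∀ θ ∈ Icc 0 Real.pi,
      F θ ≤ R * (Real.exp (-(a * θ)) + Real.exp (-(a * (Real.pi - θ)))) := by
    intro θ hθ
    have hsin : 0 ≤ Real.sin θ := Real.sin_nonneg_of_mem_Icc hθ
    simp only [hF]
    rw [abs_of_nonneg (mul_nonneg hR.le hsin)]
    gcongr
    rcases le_total θ (Real.pi / 2) with h | h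
    · refine le_add_of_le_of_nonneg (Real.exp_le_exp.2 (neg_le_neg ?_)) (Real.exp_pos _).le
      have := Real.mul_le_sin hθ.1 h
      calc a * θ = δ * (R * (2 / Real.pi * θ)) := by rw [ha]; ring
        _ ≤ _ := by gcongr
    · refine le_add_of_nonneg_of_le (Real.exp_pos _).le (Real.exp_le_exp.2 (neg_le_neg ?_))
      have := Real.mul_le_sin (x := Real.pi - θ) (by linarith [hθ.2]) (by linarith)
      rw [Real.sin_pi_sub] at this
      calc a * (Real.pi - θ) = δ * (R * (2 / Real.pi * (Real.pi - θ))) := by rw [ha]; ring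
        _ ≤ _ := by gcongr
  have hrefl : ∫ θ in (0 : ℝ)..Real.pi, Real.exp (-(a * (Real.pi - θ))) =
      ∫ θ in (0 : ℝ)..Real.pi, Real.exp (-(a * θ)) := by
    simpa using intervalIntegral.integral_comp_sub_left (fun θ => Real.exp (-(a * θ)))
      (a := 0) (b := Real.pi) Real.pi
  have hhalf : ∫ θ in (0 : ℝ)..Real.pi, F θ ≤ Real.pi / δ := by
    refine (intervalIntegral.integral_mono_on Real.pi_pos.le (hcont.intervalIntegrable _ _)
      (Continuous.intervalIntegrable (by fun_prop) _ _) hpt).trans ?_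
    rw [intervalIntegral.integral_const_mul, intervalIntegral.integral_add
      (Continuous.intervalIntegrable (by fun_prop) _ _)
      (Continuous.intervalIntegrable (by fun_prop) _ _), hrefl]
    have h := integral_exp_neg_mul_le ha0
    calc _ ≤ R * (1 / a + 1 / a) := by gcongr
      _ = Real.pi / δ := by
        rw [ha]
        have := Real.pi_pos
        field_simp
        norm_num
  have : 2 * Real.pi / δ = Real.pi / δ + Real.pi / δ := by ring
  linarith

lemma norm_circleIntegral_le_of_exp_decay {δ R A c : ℝ} (hδ : 0 < δ) (hR : 0 < R) (hA : 0 ≤ A)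
    {f : ℂ → ℂ} (hf : ∀ w ∈ Metric.sphere (c : ℂ) R, ‖f w‖ ≤ A * Real.exp (-(δ * |w.im|))) :
    ‖∮ w in C((c : ℂ), R), f w‖ ≤ A * (2 * Real.pi / δ) := by
  have hbound : ‖∮ w in C((c : ℂ), R), f w‖ ≤
      ∫ θ in (0 : ℝ)..2 * Real.pi, A * (R * Real.exp (-(δ * |R * Real.sin θ|))) := by
    rw [circleIntegral]
    refine intervalIntegral.norm_integral_le_of_norm_le Real.two_pi_pos.le
      (Eventually.of_forall fun θ _ => ?_) (Continuous.intervalIntegrable (by fun_prop) _ _)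
    have h1 := hf _ (circleMap_mem_sphere (c : ℂ) hR.le θ)
    have h2 : (circleMap (c : ℂ) R θ).im = R * Real.sin θ := by
      simp [circleMap, Complex.exp_ofReal_mul_I_im]
    rw [h2] at h1
    rw [deriv_circleMap, norm_smul, norm_mul, norm_circleMap_zero, Complex.norm_I, mul_one,
      abs_of_pos hR]
    calc R * ‖f (circleMap c R θ)‖ ≤ R * (A * Real.exp (-(δ * |R * Real.sin θ|))) := by gcongr
      _ = _ := by ring
  refine hbound.trans ?_
  rw [intervalIntegral.integral_const_mul]
  gcongr
  exact integral_exp_neg_abs_sin_le hδ hR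

/-! ### Circles separating the nodes. -/

section Circle

variable (M N : ℕ)

/-- Centre of the circle which meets the real axis in `-M - 1/2` and `N + 1/2`. -/
noncomputable def circleCenter : ℝ := ((N : ℝ) - M) / 2

/-- Radius of the circle which meets the real axis in `-M - 1/2` and `N + 1/2`. -/
noncomputable def circleRadius : ℝ := ((N : ℝ) + M + 1) / 2

lemma circleRadius_pos : 0 < circleRadius M N := by
  unfold circleRadius
  positivity

lemma abs_int_sub_center_le {k : ℤ} (hk : k ∈ Finset.Icc (-(M : ℤ)) N) :
    |(k : ℝ) - circleCenter M N| ≤ circleRadius M N - 1 / 2 := by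
  obtain ⟨h1, h2⟩ := Finset.mem_Icc.1 hk
  have h1' : -(M : ℝ) ≤ k := by exact_mod_cast h1
  have h2' : (k : ℝ) ≤ N := by exact_mod_cast h2
  unfold circleCenter circleRadius
  exact abs_le.2 ⟨by linarith, by linarith⟩

lemma le_abs_int_sub_center {k : ℤ} (hk : k ∉ Finset.Icc (-(M : ℤ)) N) :
    circleRadius M N + 1 / 2 ≤ |(k : ℝ) - circleCenter M N| := by
  unfold circleCenter circleRadius
  rcases lt_or_ge k (-(M : ℤ)) with h | h
  · have : k + 1 ≤ -(M : ℤ) := h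
    have : (k : ℝ) + 1 ≤ -M := by exact_mod_cast this
    refine le_abs.2 (Or.inr ?_)
    linarith
  · have : (N : ℤ) + 1 ≤ k := by
      by_contra h'
      exact hk (Finset.mem_Icc.2 ⟨h, by omega⟩)
    have : (N : ℝ) + 1 ≤ k := by exact_mod_cast this
    refine le_abs.2 (Or.inl ?_)
    linarith

variable {M N}

lemma abs_sub_radius_le {w : ℂ} (hw : w ∈ Metric.sphere (circleCenter M N : ℂ) (circleRadius M N))
    (x : ℝ) : |(|x - circleCenter M N| - circleRadius M N)| ≤ ‖(x : ℂ) - w‖ := by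
  rw [mem_sphere_iff_norm] at hw
  have h := abs_norm_sub_norm_le ((x : ℂ) - circleCenter M N) (w - circleCenter M N)
  rw [hw, sub_sub_sub_cancel_right, ← Complex.ofReal_sub, Complex.norm_real, Real.norm_eq_abs] at h
  exact h

/-- The circle crosses the axis at half-integers, so every integer is at least 1/2 inside or outside
it. -/
lemma half_le_norm_int_sub {w : ℂ}
    (hw : w ∈ Metric.sphere (circleCenter M N : ℂ) (circleRadius M N)) (k : ℤ) :
    1 / 2 ≤ ‖(k : ℂ) - w‖ := by
  have h := abs_sub_radius_le hw (k : ℝ)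
  rw [Complex.ofReal_intCast] at h
  refine le_trans ?_ h
  by_cases hk : k ∈ Finset.Icc (-(M : ℤ)) N
  · have := abs_int_sub_center_le M N hk
    exact le_abs.2 (Or.inr (by linarith))
  · have := le_abs_int_sub_center M N hk
    exact le_abs.2 (Or.inl (by linarith))

lemma min_le_norm_of_mem_sphere {w : ℂ}
    (hw : w ∈ Metric.sphere (circleCenter M N : ℂ) (circleRadius M N)) :
    ((min M N : ℕ) : ℝ) + 1 / 2 ≤ ‖w‖ := by
  have h := abs_sub_radius_le hw 0
  rw [Complex.ofReal_zero, zero_sub, zero_sub, norm_neg, abs_neg] at h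
  refine le_trans (le_abs.2 (Or.inr ?_)) h
  have h1 : ((min M N : ℕ) : ℝ) ≤ M := by exact_mod_cast min_le_left M N
  have h2 : ((min M N : ℕ) : ℝ) ≤ N := by exact_mod_cast min_le_right M N
  unfold circleCenter circleRadius
  rcases abs_cases (((N : ℝ) - M) / 2) with ⟨h3, _⟩ | ⟨h3, _⟩ <;> rw [h3] <;> linarith

variable {L : ℝ} {τ : ℤ → ℝ}

lemma node_mem_ball (hL : L < 1 / 4) (hτ : ∀ k : ℤ, |τ k - k| ≤ L) {k : ℤ}
    (hk : k ∈ Finset.Icc (-(M : ℤ)) N) :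
    (τ k : ℂ) ∈ Metric.ball (circleCenter M N : ℂ) (circleRadius M N) := by
  rw [mem_ball_iff_norm, ← Complex.ofReal_sub, Complex.norm_real, Real.norm_eq_abs]
  have h1 := abs_int_sub_center_le M N hk
  linarith [abs_sub_le (τ k) k (circleCenter M N), hτ k]

lemma node_notMem_closedBall (hL : L < 1 / 4) (hτ : ∀ k : ℤ, |τ k - k| ≤ L) {k : ℤ}
    (hk : k ∉ Finset.Icc (-(M : ℤ)) N) :
    (τ k : ℂ) ∉ Metric.closedBall (circleCenter M N : ℂ) (circleRadius M N) := by
  rw [mem_closedBall_iff_norm, ← Complex.ofReal_sub, Complex.norm_real, Real.norm_eq_abs, not_le]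
  have h1 := le_abs_int_sub_center M N hk
  have h2 := hτ k
  rw [abs_sub_comm] at h2
  linarith [abs_sub_le (k : ℝ) (τ k) (circleCenter M N)]

lemma quarter_le_norm_node_sub (hL : L < 1 / 4) (hτ : ∀ k : ℤ, |τ k - k| ≤ L) {w : ℂ}
    (hw : w ∈ Metric.sphere (circleCenter M N : ℂ) (circleRadius M N)) (k : ℤ) :
    1 / 4 ≤ ‖(τ k : ℂ) - w‖ := by
  have h1 := half_le_norm_int_sub hw k
  have h2 : ‖(k : ℂ) - w‖ ≤ ‖(k : ℂ) - τ k‖ + ‖(τ k : ℂ) - w‖ :=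
    norm_sub_le_norm_sub_add_norm_sub _ _ _
  have h3 : ‖(k : ℂ) - τ k‖ = |τ k - k| := by
    rw [norm_sub_rev, ← Complex.ofReal_intCast, ← Complex.ofReal_sub, Complex.norm_real,
      Real.norm_eq_abs]
  linarith [hτ k]

end Circle

/-! ### The remainder as a contour integral. -/

lemma exists_eq_prod_sub_mul {F : ℂ → ℂ} (hF : Differentiable ℂ F) (S : Finset ℂ)
    (hS : ∀ s ∈ S, F s = 0) :
    ∃ Q : ℂ → ℂ, Differentiable ℂ Q ∧ ∀ z, F z = (∏ s ∈ S, (z - s)) * Q z := by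
  induction S using Finset.induction_on with
  | empty => exact ⟨F, hF, by simp⟩
  | insert a S ha ih =>
    obtain ⟨Q, hQ, hFQ⟩ := ih fun s hs => hS s (Finset.mem_insert_of_mem hs)
    have hQa : Q a = 0 := by
      have h := hFQ a
      rw [hS a (Finset.mem_insert_self a S)] at h
      refine (mul_eq_zero.1 h.symm).resolve_left (Finset.prod_ne_zero_iff.2 fun s hs => ?_)
      exact sub_ne_zero.2 fun h => ha (h ▸ hs)
    refine ⟨dslope Q a, ?_, fun z => ?_⟩
    · have := (Complex.differentiableOn_dslope (f := Q) (univ_mem : univ ∈ 𝓝 a)).2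
        hQ.differentiableOn
      exact differentiableOn_univ.1 this
    · have h := sub_smul_dslope Q a z
      rw [hQa, sub_zero, smul_eq_mul] at h
      rw [hFQ, Finset.prod_insert ha, ← h]
      ring

/-- The two residues cancel, and for z = a the double pole has none. This is why the interpolation
terms drop out of the remainder integral. -/
lemma circleIntegral_inv_sub_mul_inv_sub {c z a : ℂ} {R : ℝ} (hz : z ∈ Metric.ball c R)
    (ha : a ∈ Metric.ball c R) : ∮ w in C(c, R), (w - z)⁻¹ * (w - a)⁻¹ = 0 := by
  have hR : 0 < R := Metric.pos_of_mem_ball hz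
  have hne : ∀ {b}, b ∈ Metric.ball c R → ∀ w ∈ Metric.sphere c R, w - b ≠ 0 := by
    intro b hb w hw h
    rw [sub_eq_zero.1 h, Metric.mem_sphere] at hw
    exact (Metric.mem_ball.1 hb).ne hw
  rcases eq_or_ne z a with rfl | hza
  · have := circleIntegral.integral_sub_zpow_of_ne (n := -2) (by norm_num) c z R
    rw [← this]
    refine circleIntegral.integral_congr hR.le fun w hw => ?_
    rw [zpow_neg, ← mul_inv]
    norm_cast
    rw [sq]
  · have hint : ∀ {b}, b ∈ Metric.ball c R → CircleIntegrable (fun w => (w - b)⁻¹) c R := by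
      intro b hb
      refine ContinuousOn.circleIntegrable hR.le (ContinuousOn.inv₀ (by fun_prop) (hne hb))
    have heq : EqOn (fun w => (w - z)⁻¹ * (w - a)⁻¹)
        (fun w => (z - a)⁻¹ * ((w - z)⁻¹ - (w - a)⁻¹)) (Metric.sphere c R) := by
      intro w hw
      have h1 := hne hz w hw
      have h2 := hne ha w hw
      have h3 := sub_ne_zero.2 hza
      simp only
      field_simp
      ring
    rw [circleIntegral.integral_congr hR.le heq, circleIntegral.integral_const_mul,
      circleIntegral.integral_sub (hint hz) (hint ha), circleIntegral.integral_sub_inv_of_mem_ball hz,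
      circleIntegral.integral_sub_inv_of_mem_ball ha, sub_self, mul_zero]

variable {L : ℝ} {τ : ℤ → ℝ}

lemma samplingKernel_eq_dslope (hL : L < 1 / 4) (hτ : ∀ k : ℤ, |τ k - k| ≤ L) (k : ℤ) (z : ℂ) :
    samplingKernel τ k z =
      (deriv (generatingFunction τ) (τ k))⁻¹ * dslope (generatingFunction τ) (τ k) z := by
  have hd := deriv_generatingFunction_ne_zero hL hτ k
  unfold samplingKernel
  split_ifs with h
  · rw [h, dslope_same, inv_mul_cancel₀ hd]
  · rw [dslope_of_ne _ h, slope_def_field, generatingFunction_apply_node hL hτ, sub_zero, div_eq_mul_inv,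
      mul_inv, div_eq_mul_inv]
    ring

lemma differentiable_samplingKernel (hL : L < 1 / 4) (hτ : ∀ k : ℤ, |τ k - k| ≤ L) (k : ℤ) :
    Differentiable ℂ (samplingKernel τ k) := by
  have h := (Complex.differentiableOn_dslope (f := generatingFunction τ)
    (univ_mem : univ ∈ 𝓝 (τ k : ℂ))).2 (differentiable_generatingFunction hL hτ).differentiableOn
  rw [show samplingKernel τ k = _ from funext (samplingKernel_eq_dslope hL hτ k)]
  exact (differentiableOn_univ.1 h).const_mul _

lemma samplingKernel_apply_node (hL : L < 1 / 4) (hτ : ∀ k : ℤ, |τ k - k| ≤ L) (k l : ℤ) :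
    samplingKernel τ k (τ l) = if k = l then 1 else 0 := by
  unfold samplingKernel
  split_ifs with h h' h'
  · rfl
  · exact absurd (injective_of_near hL hτ (Complex.ofReal_injective h)).symm h'
  · exact absurd (by rw [h']) h
  · rw [generatingFunction_apply_node hL hτ, zero_div]

/-- The remainder of the sampling series as a contour integral. -/
lemma sub_sum_samplingKernel_eq (hL : L < 1 / 4) (hτ : ∀ k : ℤ, |τ k - k| ≤ L) {Φ : ℂ → ℂ}
    (hΦ : Differentiable ℂ Φ) (M N : ℕ) {z : ℂ}
    (hz : z ∈ Metric.ball (circleCenter M N : ℂ) (circleRadius M N)) :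
    2 * Real.pi * Complex.I *
        (Φ z - ∑ k ∈ Finset.Icc (-(M : ℤ)) (N : ℤ), Φ (τ k) * samplingKernel τ k z) =
      generatingFunction τ z * ∮ w in C((circleCenter M N : ℂ), circleRadius M N),
        (w - z)⁻¹ * (Φ w / generatingFunction τ w) := by
  set c : ℂ := (circleCenter M N : ℂ) with hc
  set R : ℝ := circleRadius M N with hRdef
  set W := Finset.Icc (-(M : ℤ)) (N : ℤ) with hW
  set G := generatingFunction τ with hGdef
  have hR : 0 < R := circleRadius_pos M N
  have hGd : Differentiable ℂ G := differentiable_generatingFunction hL hτ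
  -- H vanishes at every node of the window, so after dividing numerator and denominator by the same
  -- polynomial, H/G is holomorphic on the closed disc and Cauchy's formula applies.
  set H : ℂ → ℂ := fun z => Φ z - ∑ k ∈ W, Φ (τ k) * samplingKernel τ k z with hH
  have hHd : Differentiable ℂ H := hΦ.sub (Differentiable.fun_sum fun k _ =>
    (differentiable_samplingKernel hL hτ k).const_mul _)
  set S : Finset ℂ := W.image fun k => (τ k : ℂ) with hS
  have hmemS : ∀ {k}, k ∈ W → (τ k : ℂ) ∈ S := fun hk => Finset.mem_image_of_mem _ hk
  obtain ⟨HW, hHWd, hHW⟩ := exists_eq_prod_sub_mul hHd S fun s hs => by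
    obtain ⟨l, hl, rfl⟩ := Finset.mem_image.1 hs
    simp only [hH, samplingKernel_apply_node hL hτ]
    simp [hl]
  obtain ⟨GW, hGWd, hGW⟩ := exists_eq_prod_sub_mul hGd S fun s hs => by
    obtain ⟨l, hl, rfl⟩ := Finset.mem_image.1 hs
    exact generatingFunction_apply_node hL hτ l
  -- A zero of the quotient at a node of the window would make that node a multiple zero of G.
  have hGW0 : ∀ w ∈ Metric.closedBall c R, GW w ≠ 0 := by
    intro w hw h0
    by_cases hnode : ∃ k, w = τ k
    · obtain ⟨k, rfl⟩ := hnode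
      have hk : k ∈ W := by
        by_contra hk
        exact node_notMem_closedBall hL hτ hk hw
      have hPd : DifferentiableAt ℂ (fun z : ℂ => ∏ s ∈ S, (z - s)) (τ k) := by fun_prop
      have hder := hPd.hasDerivAt.mul (hGWd (τ k)).hasDerivAt
      rw [h0, mul_zero, zero_add, Finset.prod_eq_zero (hmemS hk) (sub_self _), zero_mul] at hder
      refine deriv_generatingFunction_ne_zero hL hτ k ?_
      rw [← hGdef, show G = (fun z : ℂ => ∏ s ∈ S, (z - s)) * GW from funext hGW]
      exact hder.deriv
    · push Not at hnode
      refine generatingFunction_ne_zero hL hτ hnode ?_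
      rw [← hGdef, hGW, h0, mul_zero]
  have hψ : DiffContOnCl ℂ (fun w => HW w / GW w) (Metric.ball c R) := by
    refine DifferentiableOn.diffContOnCl fun w hw => ?_
    rw [closure_ball c hR.ne'] at hw
    exact ((hHWd w).div (hGWd w) (hGW0 w hw)).differentiableWithinAt
  have hcauchy := hψ.circleIntegral_sub_inv_smul hz
  have hne : ∀ {b}, b ∈ Metric.ball c R → ∀ w ∈ Metric.sphere c R, w - b ≠ 0 := by
    intro b hb w hw h
    rw [sub_eq_zero.1 h, Metric.mem_sphere] at hw
    exact (Metric.mem_ball.1 hb).ne hw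
  have hnodes : ∀ w ∈ Metric.sphere c R, ∀ k, w ≠ τ k := by
    intro w hw k h
    have := quarter_le_norm_node_sub hL hτ hw k
    rw [h, sub_self, norm_zero] at this
    norm_num at this
  have hG0 : ∀ w ∈ Metric.sphere c R, G w ≠ 0 := fun w hw =>
    generatingFunction_ne_zero hL hτ (hnodes w hw)
  have hsphere : EqOn (fun w => (w - z)⁻¹ • (HW w / GW w))
      (fun w => (w - z)⁻¹ * (Φ w / G w) - ∑ k ∈ W, (Φ (τ k) * (deriv G (τ k))⁻¹) *
        ((w - z)⁻¹ * (w - τ k)⁻¹)) (Metric.sphere c R) := by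
    intro w hw
    have hG := hG0 w hw
    have hP : ∏ s ∈ S, (w - s) ≠ 0 := fun h => hG (by rw [hGW, h, zero_mul])
    have h1 : HW w / GW w = H w / G w := by
      rw [hHW, hGW, mul_div_mul_left _ _ hP]
    have h2 : ∀ k, samplingKernel τ k w / G w = (deriv G (τ k))⁻¹ * (w - τ k)⁻¹ := by
      intro k
      have hwk := sub_ne_zero.2 (hnodes w hw k)
      have hd := deriv_generatingFunction_ne_zero hL hτ k
      rw [samplingKernel, if_neg (hnodes w hw k), ← hGdef]
      rw [← hGdef] at hd
      field_simp
    simp only [smul_eq_mul]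
    rw [h1]
    simp only [hH]
    rw [sub_div, Finset.sum_div, mul_sub, Finset.mul_sum]
    congr 1
    refine Finset.sum_congr rfl fun k _ => ?_
    rw [mul_div_assoc, h2]
    ring
  have hint1 : CircleIntegrable (fun w => (w - z)⁻¹ * (Φ w / G w)) c R := by
    refine ContinuousOn.circleIntegrable hR.le (ContinuousOn.mul
      (ContinuousOn.inv₀ (by fun_prop) (hne hz))
      (hΦ.continuous.continuousOn.div hGd.continuous.continuousOn hG0))
  have hint2 : ∀ k ∈ W, CircleIntegrable (fun w => (Φ (τ k) * (deriv G (τ k))⁻¹) *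
      ((w - z)⁻¹ * (w - τ k)⁻¹)) c R := by
    intro k hk
    refine ContinuousOn.circleIntegrable hR.le (continuousOn_const.mul (ContinuousOn.mul
      (ContinuousOn.inv₀ (by fun_prop) (hne hz))
      (ContinuousOn.inv₀ (by fun_prop) (hne (node_mem_ball hL hτ hk)))))
  rw [circleIntegral.integral_congr hR.le hsphere, circleIntegral.integral_sub hint1
    (CircleIntegrable.fun_sum W hint2), circleIntegral.integral_fun_sum hint2,
    Finset.sum_eq_zero (fun k hk => by
      rw [circleIntegral.integral_const_mul,
        circleIntegral_inv_sub_mul_inv_sub hz (node_mem_ball hL hτ hk), mul_zero]), sub_zero,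
    smul_eq_mul] at hcauchy
  rw [hcauchy]
  have h := hHW z
  simp only [hH] at h
  have hg := hGW0 z (Metric.ball_subset_closedBall hz)
  rw [h, hGW z]
  field_simp

/-! ### Decay of the remainder and convergence. -/

lemma norm_sub_sum_samplingKernel_le {L : ℝ} {τ : ℤ → ℝ} (hL : L < 1 / 4)
    (hτ : ∀ k : ℤ, |τ k - k| ≤ L) {δ : ℝ} (hδ : 0 < δ) {Φ : ℂ → ℂ} (hΦ : Differentiable ℂ Φ)
    {B : ℝ} (hB : ∀ z : ℂ, ‖Φ z‖ ≤ B * Real.exp ((Real.pi - δ) * |z.im|)) {M N : ℕ} {z : ℂ}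
    (h1 : 1 ≤ min M N) (hz : 2 * ‖z‖ ≤ (min M N : ℕ)) :
    ‖Φ z - ∑ k ∈ Finset.Icc (-(M : ℤ)) (N : ℤ), Φ (τ k) * samplingKernel τ k z‖ ≤
      ‖generatingFunction τ z‖ *
        (12 * Real.pi * Real.exp 23 * B / δ * ((min M N : ℕ) : ℝ) ^ (4 * L - 1)) := by
  set c : ℂ := (circleCenter M N : ℂ) with hc
  set R : ℝ := circleRadius M N with hRdef
  set ρ : ℝ := ((min M N : ℕ) : ℝ) with hρ
  have hρ1 : 1 ≤ ρ := by rw [hρ]; exact_mod_cast h1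
  have hR : 0 < R := circleRadius_pos M N
  have hB0 : 0 ≤ B := by
    have := (norm_nonneg _).trans (hB 0)
    simpa using this
  have hzball : z ∈ Metric.ball c R := by
    rw [mem_ball_iff_norm]
    refine (norm_sub_le _ _).trans_lt ?_
    have h2 : ρ ≤ M := by rw [hρ]; exact_mod_cast min_le_left M N
    have h3 : ρ ≤ N := by rw [hρ]; exact_mod_cast min_le_right M N
    rw [hc, Complex.norm_real, Real.norm_eq_abs, hRdef]
    unfold circleCenter circleRadius
    rcases abs_cases (((N : ℝ) - M) / 2) with ⟨h4, _⟩ | ⟨h4, _⟩ <;> rw [h4] <;> linarith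
  -- Here 12π = 3 · 2π · 2: the sine lower bound, the comparison with G, and |w - z| ≥ |w|/2.
  set A : ℝ := 12 * Real.pi * Real.exp 23 * B * ρ ^ (4 * L - 1) with hA
  have hA0 : 0 ≤ A := by have := Real.pi_pos; positivity
  have hbound : ∀ w ∈ Metric.sphere c R,
      ‖(w - z)⁻¹ * (Φ w / generatingFunction τ w)‖ ≤ A * Real.exp (-(δ * |w.im|)) := by
    intro w hw
    have hwρ : ρ ≤ ‖w‖ := by linarith [min_le_norm_of_mem_sphere hw]
    have hw0 : 0 < ‖w‖ := by linarith
    have hdist : ‖w‖ / 2 ≤ ‖w - z‖ := by linarith [norm_sub_norm_le w z]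
    have hsin := exp_le_norm_sin (half_le_norm_int_sub hw)
    have hG := norm_sin_le_generatingFunction hL hτ (by linarith)
      (quarter_le_norm_node_sub hL hτ hw)
    have hG0 : 0 < ‖generatingFunction τ w‖ := by
      refine norm_pos_iff.2 (generatingFunction_ne_zero hL hτ fun k h => ?_)
      have := quarter_le_norm_node_sub hL hτ hw k
      rw [h, sub_self, norm_zero] at this
      norm_num at this
    have hquot : ‖Φ w‖ / ‖generatingFunction τ w‖ ≤
        6 * Real.pi * Real.exp 23 * B * ‖w‖ ^ (4 * L) * Real.exp (-(δ * |w.im|)) := by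
      rw [div_le_iff₀ hG0]
      calc ‖Φ w‖ ≤ B * Real.exp ((Real.pi - δ) * |w.im|) := hB w
        _ = B * Real.exp (-(δ * |w.im|)) * Real.exp (Real.pi * |w.im|) := by
          rw [mul_assoc, ← Real.exp_add]
          ring_nf
        _ ≤ B * Real.exp (-(δ * |w.im|)) * (3 * (2 * Real.pi * Real.exp 23 * ‖w‖ ^ (4 * L) *
            ‖generatingFunction τ w‖)) := by
          gcongr
          exact hsin.trans (by gcongr)
        _ = _ := by ring
    rw [norm_mul, norm_inv, norm_div]
    have hpow : ‖w‖ ^ (4 * L - 1) ≤ ρ ^ (4 * L - 1) :=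
      Real.rpow_le_rpow_of_nonpos (by linarith) hwρ (by linarith)
    calc ‖w - z‖⁻¹ * (‖Φ w‖ / ‖generatingFunction τ w‖)
        ≤ (‖w‖ / 2)⁻¹ *
          (6 * Real.pi * Real.exp 23 * B * ‖w‖ ^ (4 * L) * Real.exp (-(δ * |w.im|))) := by
          gcongr
      _ = 12 * Real.pi * Real.exp 23 * B * ‖w‖ ^ (4 * L - 1) * Real.exp (-(δ * |w.im|)) := by
          rw [Real.rpow_sub_one hw0.ne']
          field_simp
          ring
      _ ≤ A * Real.exp (-(δ * |w.im|)) := by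
          rw [hA]
          have := Real.pi_pos
          gcongr
  have hint := norm_circleIntegral_le_of_exp_decay hδ hR hA0 hbound
  have heq := congrArg norm (sub_sum_samplingKernel_eq hL hτ hΦ M N hzball)
  have h2π : ‖(2 * Real.pi * Complex.I : ℂ)‖ = 2 * Real.pi := by
    simp [abs_of_pos Real.pi_pos]
  rw [norm_mul (2 * Real.pi * Complex.I : ℂ), norm_mul (generatingFunction τ z), h2π] at heq
  have h2 : 0 < 2 * Real.pi := Real.two_pi_pos
  refine le_of_mul_le_mul_left (heq.le.trans ?_) h2
  calc _ ≤ ‖generatingFunction τ z‖ * (A * (2 * Real.pi / δ)) := by gcongr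
    _ = _ := by rw [hA]; ring

/-- Lagrange interpolation of entire functions of exponential type less than `π` which are bounded
on the real line. -/
theorem tendstoUniformlyOn_sampling {L : ℝ} {τ : ℤ → ℝ} (hL : L < 1 / 4)
    (hτ : ∀ k : ℤ, |τ k - k| ≤ L) {δ : ℝ} (hδ : 0 < δ) {Φ : ℂ → ℂ} (hΦ : Differentiable ℂ Φ)
    {B : ℝ} (hB : ∀ z : ℂ, ‖Φ z‖ ≤ B * Real.exp ((Real.pi - δ) * |z.im|)) {K : Set ℂ}
    (hK : IsCompact K) :
    TendstoUniformlyOn (fun (N : ℕ × ℕ) (z : ℂ) => ∑ k ∈ Finset.Icc (-(N.1 : ℤ)) (N.2 : ℤ),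
      Φ (τ k) * samplingKernel τ k z) Φ atTop K := by
  obtain ⟨r, hr⟩ := hK.isBounded.exists_norm_le
  obtain ⟨g, hg⟩ := hK.exists_bound_of_continuousOn
    (differentiable_generatingFunction hL hτ).continuous.continuousOn
  -- In the product order, `atTop` on pairs lets both cutoffs grow independently.
  have hmin : Tendsto (fun N : ℕ × ℕ => min N.1 N.2) atTop atTop := by
    refine tendsto_atTop.2 fun b => ?_
    filter_upwards [eventually_ge_atTop (b, b)] with N hN
    exact le_min hN.1 hN.2
  set C := 12 * Real.pi * Real.exp 23 * B / δ with hC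
  have hC0 : 0 ≤ C := by
    have hB0 : 0 ≤ B := by simpa using (norm_nonneg _).trans (hB 0)
    have := Real.pi_pos
    positivity
  have hlim : Tendsto (fun N : ℕ × ℕ => g * (C * ((min N.1 N.2 : ℕ) : ℝ) ^ (4 * L - 1))) atTop
      (𝓝 0) := by
    have h := (tendsto_rpow_neg_atTop (show 0 < 1 - 4 * L by linarith)).comp
      ((tendsto_natCast_atTop_atTop (R := ℝ)).comp hmin)
    have h' := (h.const_mul C).const_mul g
    simpa [Function.comp_def] using h'
  rw [Metric.tendstoUniformlyOn_iff]
  intro ε hε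
  filter_upwards [hlim.eventually (gt_mem_nhds hε), hmin.eventually_ge_atTop 1,
    hmin.eventually_ge_atTop ⌈2 * r⌉₊] with N hN h1 h2 z hz
  rw [dist_eq_norm]
  have h3 : 2 * ‖z‖ ≤ ((min N.1 N.2 : ℕ) : ℝ) := by
    have := Nat.le_of_ceil_le h2
    linarith [hr z hz]
  refine (norm_sub_sum_samplingKernel_le hL hτ hδ hΦ hB h1 h3).trans_lt (lt_of_le_of_lt ?_ hN)
  gcongr
  exact hg z hz

end Mellin

theorem mainTheorem9 (p q : ℝ≥0∞) (hp : 1 ≤ p) (hpq : 1 / p + 1 / q = 1)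
    (δ : ℝ) (hδ : 0 < δ) (hδπ : δ < Real.pi)
    (τ : ℤ → ℝ) (hτ : ∃ L : ℝ, L < 1 / 4 ∧ ∀ k : ℤ, |τ k - (k : ℝ)| ≤ L)
    (f g : ℝ → ℂ) (hf : f ∈ Mellin.bernsteinSpace p (Real.pi - δ)) (hg : Mellin.MemX q g) :
    -- the objects in the formula are well defined
    (∀ z : ℂ, Multipliable (Mellin.samplingFactor τ z)) ∧
    Differentiable ℂ (Mellin.generatingFunction τ) ∧
    (∀ k : ℤ, deriv (Mellin.generatingFunction τ) (τ k : ℂ) ≠ 0) ∧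
    (∀ t : ℝ, IntegrableOn (fun x : ℝ => f (Real.exp t * x) * g x / (x : ℂ)) (Ioi 0)) ∧
    -- the entire extension of the pairing is the sum of the two-sided sampling series
    ∃ Φ : ℂ → ℂ, Differentiable ℂ Φ ∧ (∀ t : ℝ, Φ (t : ℂ) = Mellin.pairing f g t) ∧
      ∀ K : Set ℂ, IsCompact K →
        TendstoUniformlyOn
          (fun (N : ℕ × ℕ) (z : ℂ) => ∑ k ∈ Finset.Icc (-(N.1 : ℤ)) (N.2 : ℤ),
            Mellin.pairing f g (τ k) * Mellin.samplingKernel τ k z)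
          Φ atTop K := by
  obtain ⟨L, hL, hτ⟩ := hτ
  have hp0 : p ≠ 0 := (zero_lt_one.trans_le hp).ne'
  have hσ : 0 ≤ Real.pi - δ := by linarith
  have hfX : Mellin.MemX p f := by
    obtain ⟨F, hF0, hF, -⟩ := hf
    exact hF0 ▸ (hF 0).1
  obtain ⟨D, B, hD0, hD, hB⟩ := Mellin.exists_pairing_derivatives hp0 hpq hσ hf hg
  obtain ⟨Φ, hΦ, hΦD, hΦB⟩ := Mellin.exists_entire_extension hD hσ hB
  have hreal : ∀ t : ℝ, Φ t = Mellin.pairing f g t := fun t => by rw [hΦD, hD0]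
  refine ⟨Mellin.multipliable_samplingFactor hL hτ,
    Mellin.differentiable_generatingFunction hL hτ,
    Mellin.deriv_generatingFunction_ne_zero hL hτ,
    fun t => Mellin.integrableOn_pairing hp0 hpq hfX hg t, Φ, hΦ, hreal, fun K hK => ?_⟩
  simp_rw [← hreal]
  exact Mellin.tendstoUniformlyOn_sampling hL hτ hδ hΦ hΦB hK
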